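/- Let $q\in\mathbb C$ with $0<|q|<1$, put $(z;q)_\infty=\prod_{j\ge 0}(1-zq^j)$ and $(z_1,\dots,z_m;q)_\infty=(z_1;q)_\infty\cdots(z_m;q)_\infty$. For $\alpha,\beta\in\mathbb C^r$ and a function $g$ of $t=(t_1,\dots,t_r)$, the $r$-fold Jackson $q$-integral is $$\int_{\alpha_1}^{\beta_1}\!\!\cdots\int_{\alpha_r}^{\beta_r} g(t)\,d_qt_r\cdots d_qt_1=\sum_{S\subseteq\{1,\dots,r\}}\Big(\prod_{i\in S}(-\alpha_i)\Big)\Big(\prod_{i\notin S}\beta_i\Big)(1-q)^r\sum_{k_1,\dots,k_r=0}^\infty g\big(c_1(S)q^{k_1},\dots,c_r(S)q^{k_r}\big)q^{k_1+\dots+k_r},$$ where $c_i(S)=\alpha_i$ if $i\in S$ and $c_i(S)=\beta_i$ if $i\notin S$. **Theorem 4.1.** Let $r\ge 0$ be an integer and let $a,b,c,d,e,f,x_1,\dots,x_r\in\mathbb C$ with $a\ne0$, all $x_i\neq 0$, and $a^2q^{2-r}=bcdef$. Assume that no denominator below vanishes, that is, none of $ax_i^2,\ bx_i,\ cx_i,\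 dx_i,\ ex_i,\ f,\ b^2/a,\ bc/a,\ bd/a,\ be/a,\ bf/(ax_i)$ $(1\le i\le r)$ is of the form $q^{-k}$ with an integer $k\ge0$. Then all the multiple series in the following $q$-integral converge absolutely, and $$\int_{ax_1}^{b}\!\!\cdots\int_{ax_r}^{b}\prod_{1\le i<j\le r}(t_i-t_j)\Big(1-\frac{t_it_j}{a}\Big)\prod_{i=1}^r\Big(1-\frac{t_i^2}{a}\Big)\prod_{i=1}^r\frac{\big(\frac{qt_i}{ax_i},\frac{qt_i}{b},\frac{qt_i}{c},\frac{qt_i}{d},\frac{qt_i}{e},\frac{qt_ix_i}{f};q\big)_\infty}{\big(t_ix_i,\frac{bt_i}{a},\frac{ct_i}{a},\frac{dt_i}{a},\frac{et_i}{a},\frac{ft_i}{ax_i};q\big)_\infty}\,d_qt_r\cdots d_qt_1$$ $$=a^{\binom r2}b^r(1-q)^r\prod_{1\le i<j\le r}(x_i-x_j)\Big(1-\frac{ax_ix_j}{f}\Big)\prod_{i=1}^r\frac{\big(q,\frac{ax_i}{b},\frac{bq}{ax_i},\frac{aq^{2-i}}{cd},\frac{aq^{2-i}}{ce};q\big)_\infty}{(bx_i,cx_i,dx_i,ex_i,f;q)_\infty}\prod_{i=1}^r\frac{\big(\frac{ax_iq}{cf},\frac{aq^{2-i}}{de},\frac{ax_iq}{df},\frac{ax_iq}{ef};q\big)_\infty}{\big(\frac{bcq^{i-1}}{a},\frac{bdq^{i-1}}{a},\frac{beq^{i-1}}{a},\frac{bf}{ax_i};q\big)_\infty}.$$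 -/

import Mathlib

noncomputable section

/-- The infinite `q`-shifted factorial `(z; q)_∞ = ∏_{j ≥ 0} (1 - z q ^ j)`. -/
def qFac (q z : ℂ) : ℂ := ∏' j : ℕ, (1 - z * q ^ j)

/-- For `|q| < 1` the product that defines `(z; q)_∞` converges unconditionally. -/
theorem multipliable_qFac {q : ℂ} (hq : ‖q‖ < 1) (z : ℂ) :
    Multipliable fun j : ℕ => 1 - z * q ^ j := by
  have h : Summable fun j : ℕ => ‖-(z * q ^ j)‖ := by
    simpa [norm_mul, norm_pow] using
      (summable_geometric_of_lt_one (norm_nonneg q) hq).mul_left ‖z‖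
  simpa [sub_eq_add_neg] using multipliable_one_add_of_summable h

/-- The condensed notation `(z₁, …, zₘ; q)_∞ = (z₁; q)_∞ ⋯ (zₘ; q)_∞`. -/
def qFacs (q : ℂ) (l : List ℂ) : ℂ := (l.map (qFac q)).prod

/-- The point `(c₁(S) q ^ k₁, …, c_r(S) q ^ k_r)`, where `c_i(S) = α_i` for `i ∈ S` and
`c_i(S) = β_i` for `i ∉ S`. -/
def qNode {r : ℕ} (q : ℂ) (α β : Fin r → ℂ) (S : Finset (Fin r)) (k : Fin r → ℕ) :
    Fin r → ℂ :=
  fun i => (if i ∈ S then α i else β i) * q ^ k i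

/-- The term of index `k` in the multiple series that belongs to the subset `S` in the multiple
Jackson `q`-integral of `g`. -/
def qIntegralTerm {r : ℕ} (q : ℂ) (α β : Fin r → ℂ) (g : (Fin r → ℂ) → ℂ)
    (S : Finset (Fin r)) (k : Fin r → ℕ) : ℂ :=
  g (qNode q α β S k) * q ^ (∑ i, k i)

/-- Absolute convergence of all `2 ^ r` multiple series in the multiple Jackson `q`-integral
(in `ℂ`, unconditional and absolute summability agree). -/
def QIntegrable {r : ℕ} (q : ℂ) (α β : Fin r → ℂ) (g : (Fin r → ℂ) → ℂ) : Prop :=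
  ∀ S : Finset (Fin r), Summable (qIntegralTerm q α β g S)

/-- The multiple Jackson `q`-integral
`∫_{α₁}^{β₁} ⋯ ∫_{α_r}^{β_r} g(t₁, …, t_r) d_q t_r ⋯ d_q t₁`. -/
def qIntegral {r : ℕ} (q : ℂ) (α β : Fin r → ℂ) (g : (Fin r → ℂ) → ℂ) : ℂ :=
  ∑ S : Finset (Fin r),
    (∏ i ∈ S, -α i) * (∏ i ∈ Sᶜ, β i) * (1 - q) ^ r *
      ∑' k : Fin r → ℕ, qIntegralTerm q α β g S k

/-- The integrand of the `C_r` integral. -/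
def crIntegrand {r : ℕ} (q a b c d e f : ℂ) (x t : Fin r → ℂ) : ℂ :=
  (∏ i, ∏ j ∈ Finset.Ioi i, (t i - t j) * (1 - t i * t j / a)) *
    (∏ i, (1 - t i ^ 2 / a)) *
    ∏ i,
      qFacs q [q * t i / (a * x i), q * t i / b, q * t i / c, q * t i / d, q * t i / e,
          q * t i * x i / f] /
        qFacs q [t i * x i, b * t i / a, c * t i / a, d * t i / a, e * t i / a,
          f * t i / (a * x i)]

end

/-! Up to the constant `(-a) ^ r.choose 2`, the factors `(t_i - t_j)(1 - t_i t_j / a)` form a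
Vandermonde determinant in the projective coordinate `(t : t² + a)`, that is, in `T = t + a/t`. The
rest of the integrand is a product of one-variable very-well-poised weights. The multiple integral
is therefore a determinant of one-dimensional Jackson integrals (`qIntegral_det`, `crIntegrand_eq`).

Column operations make the entries summable. Replace the powers of `T` by the products of `T - α_l`
for `l < j` and `T - β_m` for `m < r - 1 - j`, where `α_l = c q^l + a/(c q^l)` and `β_m = d q^m +
a/(d q^m)`. Inserting such a product only moves `c` to `c q^j` and `d` to `d q^(r-1-j)`
(`jacksonForm_shift`). The total shift is always `r - 1`, so the balancing condition turns every new
entry into a nonterminating balanced very-well-poised `₈φ₇`, which `jacksonForm_eq` sums. The value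
is a row factor times a column factor times a product of the same kind in `x + κ/x`, with `κ = f/a`
(`jacksonForm_sum_coeff`), so a second Vandermonde determinant appears, now in the `x_i`. The two
changes of basis have explicit determinants (`det_coeff_splitPoly`), whose quotient
(`splitConst_ratio`) supplies the missing factors. A degenerate basis is reached by continuity in
`det_jacksonForm`.

The `₈φ₇` sum is itself proved by a Liouville argument. A telescoping identity gives a relation
between the shifts `c → qc` and `d → qd` (`jacksonForm_contiguous`), and the theta-like `pairFactor`
obeys the same relation. With `c d` fixed, the quotient is invariant under `c → qc`, hence constant
(`qPeriodic_ratio_const`). The constant is read off at `p c = a`, where one series vanishes from the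
form and the other has a single term (`jacksonForm_of_mul_eq`). Size restrictions on the parameters
are removed by the identity theorem. -/

open Filter Topology

/-! ### Finite and infinite q-shifted factorials. -/

/-- The finite `q`-shifted factorial `(z; q)_k`. -/
def qPoch (q z : ℂ) (k : ℕ) : ℂ := ∏ l ∈ Finset.range k, (1 - z * q ^ l)

@[simp] theorem qPoch_zero (q z : ℂ) : qPoch q z 0 = 1 := by simp [qPoch]

theorem qPoch_succ (q z : ℂ) (k : ℕ) : qPoch q z (k + 1) = qPoch q z k * (1 - z * q ^ k) := by
  simp [qPoch, Finset.prod_range_succ]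

theorem qPoch_succ' (q z : ℂ) (k : ℕ) : qPoch q z (k + 1) = (1 - z) * qPoch q (z * q) k := by
  simp only [qPoch, Finset.prod_range_succ', pow_zero, mul_one]
  rw [mul_comm]
  congr 1
  refine Finset.prod_congr rfl fun l _ => ?_
  ring

theorem qPoch_one_succ (q : ℂ) (k : ℕ) : qPoch q 1 (k + 1) = 0 := by
  simp [qPoch_succ']

theorem qPoch_ne_zero {q z : ℂ} (h : ∀ k : ℕ, z * q ^ k ≠ 1) (k : ℕ) : qPoch q z k ≠ 0 :=
  Finset.prod_ne_zero_iff.mpr fun l _ => sub_ne_zero.mpr (h l).symm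

section
variable {q : ℂ} (hq : ‖q‖ < 1)
include hq

theorem summable_norm_qFac (z : ℂ) : Summable fun j : ℕ => ‖-(z * q ^ j)‖ := by
  simpa [norm_mul, norm_pow] using
    (summable_geometric_of_lt_one (norm_nonneg q) hq).mul_left ‖z‖

theorem qFac_eq_one_sub_mul (z : ℂ) : qFac q z = (1 - z) * qFac q (z * q) := by
  have h : ∀ j : ℕ, 1 - z * q * q ^ j = 1 - z * q ^ (j + 1) := fun j => by ring
  have h1 := tprod_eq_zero_mul' (f := fun j : ℕ => 1 - z * q ^ j)
    ((multipliable_qFac hq (z * q)).congr h)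
  simpa [qFac, h] using h1

theorem qFac_eq_qPoch_mul (z : ℂ) (k : ℕ) : qFac q z = qPoch q z k * qFac q (z * q ^ k) := by
  induction k with
  | zero => simp
  | succ k ih =>
    rw [ih, qFac_eq_one_sub_mul hq (z * q ^ k), qPoch_succ, pow_succ]
    ring_nf

theorem qFac_one : qFac q 1 = 0 := by
  simp [qFac_eq_one_sub_mul hq 1]

theorem qFac_ne_zero {z : ℂ} (h : ∀ k : ℕ, z * q ^ k ≠ 1) : qFac q z ≠ 0 := by
  have := tprod_one_add_ne_zero_of_summable (f := fun j : ℕ => -(z * q ^ j))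
    (fun j => by
      rw [← sub_eq_add_neg]
      exact sub_ne_zero.mpr (h j).symm) (summable_norm_qFac hq z)
  simpa [qFac, sub_eq_add_neg] using this

theorem qFac_ne_zero_of_norm_lt {z : ℂ} (h : ‖z‖ < 1) : qFac q z ≠ 0 := by
  refine qFac_ne_zero hq fun k hk => ?_
  have h1 : ‖z * q ^ k‖ < 1 := by
    rw [norm_mul, norm_pow]
    calc ‖z‖ * ‖q‖ ^ k ≤ ‖z‖ * 1 := by
          gcongr
          exact pow_le_one₀ (norm_nonneg _) hq.le
      _ < 1 := by simpa using h
  rw [hk] at h1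
  simp at h1

theorem norm_qPoch_le (z : ℂ) (k : ℕ) : ‖qPoch q z k‖ ≤ Real.exp (‖z‖ / (1 - ‖q‖)) := by
  have h1 : ∀ l ∈ Finset.range k, ‖1 - z * q ^ l‖ ≤ Real.exp (‖z‖ * ‖q‖ ^ l) := by
    intro l _
    calc ‖1 - z * q ^ l‖ ≤ ‖(1 : ℂ)‖ + ‖z * q ^ l‖ := norm_sub_le _ _
      _ = ‖z‖ * ‖q‖ ^ l + 1 := by simp [add_comm]
      _ ≤ _ := Real.add_one_le_exp _
  calc ‖qPoch q z k‖ = ∏ l ∈ Finset.range k, ‖1 - z * q ^ l‖ := by simp [qPoch]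
    _ ≤ ∏ l ∈ Finset.range k, Real.exp (‖z‖ * ‖q‖ ^ l) :=
        Finset.prod_le_prod (fun _ _ => norm_nonneg _) h1
    _ = Real.exp (‖z‖ * ∑ l ∈ Finset.range k, ‖q‖ ^ l) := by
        rw [← Real.exp_sum, Finset.mul_sum]
    _ ≤ _ := by
        rw [div_eq_mul_inv]
        gcongr
        rw [← tsum_geometric_of_lt_one (norm_nonneg q) hq]
        exact (summable_geometric_of_lt_one (norm_nonneg q) hq).sum_le_tsum _
          (fun _ _ => by positivity)

theorem tendsto_qPoch (z : ℂ) : Tendsto (qPoch q z) atTop (𝓝 (qFac q z)) :=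
  (multipliable_qFac hq z).tendsto_prod_tprod_nat

theorem norm_qFac_le (z : ℂ) : ‖qFac q z‖ ≤ Real.exp (‖z‖ / (1 - ‖q‖)) :=
  le_of_tendsto (tendsto_qPoch hq z).norm (Eventually.of_forall fun k => norm_qPoch_le hq z k)

theorem differentiable_qFac : Differentiable ℂ (qFac q) := by
  intro z
  have hU : IsOpen (Metric.ball (0 : ℂ) (‖z‖ + 1)) := Metric.isOpen_ball
  have hsum : Summable fun j : ℕ => (‖z‖ + 1) * ‖q‖ ^ j :=
    (summable_geometric_of_lt_one (norm_nonneg q) hq).mul_left _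
  have hp := hsum.hasProdLocallyUniformlyOn_nat_one_add (f := fun j (z : ℂ) => -(z * q ^ j)) hU
    (Eventually.of_forall fun j w hw => by
      have : ‖w‖ ≤ ‖z‖ + 1 := by simpa using (mem_ball_zero_iff.mp hw).le
      simpa [norm_mul, norm_pow] using mul_le_mul_of_nonneg_right this (by positivity))
    (fun j => by fun_prop)
  have hd := hp.differentiableOn
    (Eventually.of_forall fun s => by fun_prop) hU
  have := hd.differentiableAt (x := z) (hU.mem_nhds (by simp))
  refine this.congr_of_eventuallyEq (Eventually.of_forall fun w => ?_)
  simp [qFac, sub_eq_add_neg]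

theorem continuous_qFac : Continuous (qFac q) := (differentiable_qFac hq).continuous

theorem tendsto_qFac_mul_pow (z : ℂ) :
    Tendsto (fun k : ℕ => qFac q (z * q ^ k)) atTop (𝓝 1) := by
  have h0 : qFac q 0 = 1 := by simp [qFac]
  rw [← h0]
  refine ((continuous_qFac hq).tendsto 0).comp ?_
  simpa using (tendsto_pow_atTop_nhds_zero_of_norm_lt_one hq).const_mul z

end

theorem differentiable_qPoch (q : ℂ) (k : ℕ) : Differentiable ℂ fun z => qPoch q z k := by
  unfold qPoch
  fun_prop

/-! ### Very-well-poised Jackson series and their holomorphy in the parameters. -/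

/-- The factor `(p q ^ (k + 1) / u; q)_∞ (p u / a; q)_k` that a parameter `u` contributes to the
Jackson series with nodes `p q ^ k`, after the denominator `(p u / a; q)_∞` is cleared. -/
noncomputable def nodeFactor (q a : ℂ) (k : ℕ) (p u : ℂ) : ℂ :=
  qFac q (p * q ^ (k + 1) / u) * qPoch q (p * u / a) k

/-- The `k`-th term of the very-well-poised Jackson series with nodes `p q ^ k`. -/
noncomputable def jacksonTerm (q a p b c d e g : ℂ) (k : ℕ) : ℂ :=
  q ^ k * (1 - (p * q ^ k) ^ 2 / a) *
    (nodeFactor q a k p p * nodeFactor q a k p b * nodeFactor q a k p c * nodeFactor q a k p d *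
      nodeFactor q a k p e * nodeFactor q a k p g)

/-- The very-well-poised Jackson series with nodes `p q ^ k` and an additional weight `m`. -/
noncomputable def jacksonSeries (q a : ℂ) (m : ℂ → ℂ) (p b c d e g : ℂ) : ℂ :=
  ∑' k : ℕ, m (p * q ^ k) * jacksonTerm q a p b c d e g k

/-- A bound for `nodeFactor`. -/
noncomputable def nodeBound (q a p u : ℂ) : ℝ :=
  Real.exp (‖p / u‖ / (1 - ‖q‖)) * Real.exp (‖p * u / a‖ / (1 - ‖q‖))

/-- A bound for `jacksonTerm`, up to the factor `‖q‖ ^ k`. -/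
noncomputable def jacksonBound (q a p b c d e g : ℂ) : ℝ :=
  (1 + ‖p ^ 2 / a‖) * (nodeBound q a p p * nodeBound q a p b * nodeBound q a p c *
    nodeBound q a p d * nodeBound q a p e * nodeBound q a p g)

section
variable {q : ℂ} (hq : ‖q‖ < 1)
include hq

theorem norm_pow_le_one (k : ℕ) : ‖q ^ k‖ ≤ 1 := by
  rw [norm_pow]
  exact pow_le_one₀ (norm_nonneg _) hq.le

theorem norm_nodeFactor_le (a : ℂ) (k : ℕ) (p u : ℂ) :
    ‖nodeFactor q a k p u‖ ≤ nodeBound q a p u := by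
  have h0 : 0 < 1 - ‖q‖ := by linarith
  rw [nodeFactor, norm_mul, nodeBound]
  refine mul_le_mul ((norm_qFac_le hq _).trans ?_) (norm_qPoch_le hq _ _) (norm_nonneg _)
    (Real.exp_nonneg _)
  have : ‖p * q ^ (k + 1) / u‖ ≤ ‖p / u‖ := by
    rw [show p * q ^ (k + 1) / u = p / u * q ^ (k + 1) by ring, norm_mul]
    exact mul_le_of_le_one_right (norm_nonneg _) (norm_pow_le_one hq _)
  gcongr

theorem norm_jacksonTerm_le (a p b c d e g : ℂ) (k : ℕ) :
    ‖jacksonTerm q a p b c d e g k‖ ≤ jacksonBound q a p b c d e g * ‖q‖ ^ k := by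
  have h1 : ‖1 - (p * q ^ k) ^ 2 / a‖ ≤ 1 + ‖p ^ 2 / a‖ := by
    refine (norm_sub_le _ _).trans ?_
    rw [norm_one, show (p * q ^ k) ^ 2 / a = p ^ 2 / a * q ^ (k * 2) by ring, norm_mul]
    gcongr
    exact mul_le_of_le_one_right (norm_nonneg _) (norm_pow_le_one hq _)
  have h2 := norm_nodeFactor_le hq a k p
  rw [jacksonTerm, jacksonBound, mul_assoc, norm_mul, norm_pow, mul_comm]
  simp only [norm_mul]
  gcongr <;> first | exact h2 _ | (simp only [nodeBound]; positivity)

theorem exists_weight_bound {m : ℂ → ℂ} (hm : Continuous m) (r : ℝ) :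
    ∃ C : ℝ, 0 ≤ C ∧ ∀ p : ℂ, ‖p‖ ≤ r → ∀ k : ℕ, ‖m (p * q ^ k)‖ ≤ C := by
  obtain ⟨C, hC⟩ := (isCompact_closedBall (0 : ℂ) r).exists_bound_of_continuousOn hm.continuousOn
  refine ⟨max C 0, le_max_right _ _, fun p hp k => (hC _ ?_).trans (le_max_left _ _)⟩
  rw [mem_closedBall_zero_iff, norm_mul]
  exact (mul_le_of_le_one_right (norm_nonneg _) (norm_pow_le_one hq _)).trans hp

theorem summable_jackson {m : ℂ → ℂ} (hm : Continuous m) (a p b c d e g : ℂ) :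
    Summable fun k : ℕ => m (p * q ^ k) * jacksonTerm q a p b c d e g k := by
  obtain ⟨C, hC0, hC⟩ := exists_weight_bound hq hm ‖p‖
  refine Summable.of_norm_bounded (g := fun k => C * (jacksonBound q a p b c d e g * ‖q‖ ^ k))
    (((summable_geometric_of_lt_one (norm_nonneg q) hq).mul_left _).mul_left _) fun k => ?_
  rw [norm_mul]
  gcongr
  · exact hC p le_rfl k
  · exact norm_jacksonTerm_le hq a p b c d e g k

/-- The bound `jacksonBound` is continuous in the parameters, so near each point the series has a
uniform geometric majorant and Weierstrass' theorem applies. Clearing denominators in `nodeFactor`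
leaves `0` as the only value to be avoided. -/
theorem differentiableOn_jacksonSeries {m : ℂ → ℂ} (hm : Differentiable ℂ m) (a : ℂ) {U : Set ℂ}
    (hU : IsOpen U) {p b c d e g : ℂ → ℂ} (hp : DifferentiableOn ℂ p U)
    (hb : DifferentiableOn ℂ b U) (hc : DifferentiableOn ℂ c U) (hd : DifferentiableOn ℂ d U)
    (he : DifferentiableOn ℂ e U) (hg : DifferentiableOn ℂ g U)
    (hp0 : ∀ s ∈ U, p s ≠ 0) (hb0 : ∀ s ∈ U, b s ≠ 0) (hc0 : ∀ s ∈ U, c s ≠ 0)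
    (hd0 : ∀ s ∈ U, d s ≠ 0) (he0 : ∀ s ∈ U, e s ≠ 0) (hg0 : ∀ s ∈ U, g s ≠ 0) :
    DifferentiableOn ℂ (fun s => jacksonSeries q a m (p s) (b s) (c s) (d s) (e s) (g s)) U := by
  have hfac : ∀ {u : ℂ → ℂ}, DifferentiableOn ℂ u U → (∀ s ∈ U, u s ≠ 0) → ∀ k,
      DifferentiableOn ℂ (fun s => nodeFactor q a k (p s) (u s)) U := fun {u} hu hu0 k => by
    unfold nodeFactor
    refine DifferentiableOn.mul ?_ ?_
    · exact (differentiable_qFac hq).comp_differentiableOn ((hp.mul_const _).div hu hu0)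
    · exact (differentiable_qPoch q k).comp_differentiableOn ((hp.mul hu).div_const _)
  have hbd : ∀ {u : ℂ → ℂ}, DifferentiableOn ℂ u U → (∀ s ∈ U, u s ≠ 0) →
      ContinuousOn (fun s => nodeBound q a (p s) (u s)) U := fun {u} hu hu0 => by
    unfold nodeBound
    have h1 := (hp.div hu hu0).continuousOn
    have h2 := ((hp.mul hu).div_const a).continuousOn
    exact (Real.continuous_exp.comp_continuousOn (h1.norm.div_const _)).mul
      (Real.continuous_exp.comp_continuousOn (h2.norm.div_const _))
  have hB : ContinuousOn (fun s => jacksonBound q a (p s) (b s) (c s) (d s) (e s) (g s)) U := by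
    unfold jacksonBound
    exact (continuousOn_const.add ((hp.pow 2).div_const a).continuousOn.norm).mul
      ((((((hbd hp hp0).mul (hbd hb hb0)).mul (hbd hc hc0)).mul (hbd hd hd0)).mul
        (hbd he he0)).mul (hbd hg hg0))
  have hterm : ∀ k, DifferentiableOn ℂ (fun s => m (p s * q ^ k) *
      jacksonTerm q a (p s) (b s) (c s) (d s) (e s) (g s) k) U := fun k => by
    unfold jacksonTerm
    refine (hm.comp_differentiableOn (hp.mul_const _)).mul (DifferentiableOn.mul ?_ ?_)
    · exact ((((hp.mul_const _).pow 2).div_const a).const_sub 1).const_mul _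
    · exact (((((hfac hp hp0 k).mul (hfac hb hb0 k)).mul (hfac hc hc0 k)).mul
        (hfac hd hd0 k)).mul (hfac he he0 k)).mul (hfac hg hg0 k)
  intro s hs
  obtain ⟨C, hC0, hC⟩ := exists_weight_bound hq hm.continuous (‖p s‖ + 1)
  have e1 : ∀ᶠ y in 𝓝 s, jacksonBound q a (p y) (b y) (c y) (d y) (e y) (g y) <
      jacksonBound q a (p s) (b s) (c s) (d s) (e s) (g s) + 1 :=
    (hB.continuousAt (hU.mem_nhds hs)).eventually_lt_const (by simp)
  have e2 : ∀ᶠ y in 𝓝 s, ‖p y‖ < ‖p s‖ + 1 :=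
    (hp.continuousOn.continuousAt (hU.mem_nhds hs)).norm.eventually_lt_const (by simp)
  obtain ⟨V, hV, hVo, hsV⟩ := eventually_nhds_iff.mp (e1.and (e2.and (hU.mem_nhds hs)))
  have := Complex.differentiableOn_tsum_of_summable_norm
    (((summable_geometric_of_lt_one (norm_nonneg q) hq).mul_left
      (jacksonBound q a (p s) (b s) (c s) (d s) (e s) (g s) + 1)).mul_left C)
    (fun k => (hterm k).mono fun y hy => (hV y hy).2.2) hVo
    (fun k y hy => by
      rw [norm_mul]
      refine mul_le_mul (hC _ (hV y hy).2.1.le k) ?_ (norm_nonneg _) hC0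
      refine (norm_jacksonTerm_le hq _ _ _ _ _ _ _ k).trans ?_
      gcongr
      exact (hV y hy).1.le)
  exact (this.differentiableAt (hVo.mem_nhds hsV)).differentiableWithinAt

end

/-! ### Telescoping and the contiguous relation. -/

/-- This is the telescoping step at the node `t`. After multiplication by the factors common to both
sides, the two six-fold products on the right become consecutive values of one sequence. -/
theorem vwp_identity {a p b u v e g t : ℂ} (ha : a ≠ 0) (hp : p ≠ 0) (hu : u ≠ 0)
    (hv : v ≠ 0) (he : e ≠ 0) (hg : g ≠ 0) (hb : b = a ^ 3 / (p * u * v * e * g)) :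
    t * (1 - t ^ 2 / a) *
      (u ^ 2 * ((1 - p * v / a) * (1 - b * v / a) * (1 - e * v / a) * (1 - g * v / a)) *
          (1 - t / u) * (1 - t * u / a) -
        v ^ 2 * ((1 - p * u / a) * (1 - b * u / a) * (1 - e * u / a) * (1 - g * u / a)) *
          (1 - t / v) * (1 - t * v / a)) =
      u * v * (v - u) *
        ((1 - t / p) * (1 - t / b) * (1 - t / u) * (1 - t / v) * (1 - t / e) * (1 - t / g) -
          (1 - t * p / a) * (1 - t * b / a) * (1 - t * u / a) * (1 - t * v / a) *
            (1 - t * e / a) * (1 - t * g / a)) := by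
  subst hb
  field_simp
  ring

/-- The case `t = p` of `vwp_identity`, where the first product vanishes, with `(1 - p²/a)(1 -
pu/a)(1 - pv/a)` cancelled. It is kept separate so that these factors need not be nonzero. -/
theorem vwp_identity_start {a p b u v e g : ℂ} (ha : a ≠ 0) (hp : p ≠ 0) (hu : u ≠ 0)
    (hv : v ≠ 0) (he : e ≠ 0) (hg : g ≠ 0) (hb : b = a ^ 3 / (p * u * v * e * g)) :
    p *
      (u ^ 2 * ((1 - b * v / a) * (1 - e * v / a) * (1 - g * v / a)) * (1 - p / u) -
        v ^ 2 * ((1 - b * u / a) * (1 - e * u / a) * (1 - g * u / a)) * (1 - p / v)) =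
      -(u * v * (v - u) *
          ((1 - p * b / a) * (1 - p * e / a) * (1 - p * g / a))) := by
  subst hb
  field_simp
  ring

theorem nodeFactor_telescope (q a : ℂ) (k : ℕ) (p u : ℂ) :
    qFac q (p * q ^ (k + 1) / u) * qPoch q (p * u / a) (k + 1) =
      nodeFactor q a k p u * (1 - p * q ^ k * u / a) := by
  rw [nodeFactor, qPoch_succ]
  ring

section
variable {q : ℂ} (hq : ‖q‖ < 1)
include hq

theorem nodeFactor_eq_one_sub_mul (a : ℂ) (k : ℕ) (p u : ℂ) :
    qFac q (p * q ^ k / u) * qPoch q (p * u / a) k =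
      (1 - p * q ^ k / u) * nodeFactor q a k p u := by
  rw [nodeFactor, qFac_eq_one_sub_mul hq (p * q ^ k / u)]
  ring_nf

theorem tendsto_nodeFactor (a p u : ℂ) :
    Tendsto (fun k => nodeFactor q a k p u) atTop (𝓝 (qFac q (p * u / a))) := by
  have h1 := ((tendsto_qFac_mul_pow hq (p / u)).comp (tendsto_add_atTop_nat 1)).mul
    (tendsto_qPoch hq (p * u / a))
  rw [one_mul] at h1
  refine h1.congr fun k => ?_
  simp only [nodeFactor, Function.comp]
  ring_nf

end

/-- The combination of the two summands is a difference of consecutive values of a sequence `G`, so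
only the limit of `G` survives. -/
theorem jacksonSeries_contiguous {q : ℂ} (hq : ‖q‖ < 1) (hq0 : q ≠ 0) {a p b u v e g : ℂ}
    (ha : a ≠ 0) (hp : p ≠ 0) (hu : u ≠ 0) (hv : v ≠ 0) (he : e ≠ 0) (hg : g ≠ 0)
    (hbal : p * b * u * v * e * g = a ^ 3) :
    p * (u ^ 2 * ((1 - b * v / a) * (1 - e * v / a) * (1 - g * v / a)) *
          jacksonSeries q a (fun _ => 1) p b (q * u) v e g -
        v ^ 2 * ((1 - b * u / a) * (1 - e * u / a) * (1 - g * u / a)) *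
          jacksonSeries q a (fun _ => 1) p b u (q * v) e g) =
      -(u * v * (v - u) * (qFac q (p * p / a) * qFac q (p * b / a) * qFac q (p * e / a) *
          qFac q (p * g / a) * qFac q (p * (q * u) / a) * qFac q (p * (q * v) / a))) := by
  have hb : b = a ^ 3 / (p * u * v * e * g) := by
    rw [← hbal]; field_simp
  have hs1 := summable_jackson hq (m := fun _ => 1) continuous_const a p b (q * u) v e g
  have hs2 := summable_jackson hq (m := fun _ => 1) continuous_const a p b u (q * v) e g
  have hs := ((hs1.hasSum.mul_left (u ^ 2 * ((1 - b * v / a) * (1 - e * v / a) *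
      (1 - g * v / a)))).sub (hs2.hasSum.mul_left (v ^ 2 * ((1 - b * u / a) * (1 - e * u / a) *
      (1 - g * u / a))))).mul_left p
  set G : ℕ → ℂ := fun k => nodeFactor q a k p p * nodeFactor q a k p b * nodeFactor q a k p e *
      nodeFactor q a k p g * ((1 - p * q ^ k * p / a) * (1 - p * q ^ k * b / a) *
        (1 - p * q ^ k * e / a) * (1 - p * q ^ k * g / a)) *
      (qFac q (p * q ^ (k + 1) / u) * qPoch q (p * (q * u) / a) k) *
      (qFac q (p * q ^ (k + 1) / v) * qPoch q (p * (q * v) / a) k) with hG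
  -- The value before `G 0` is set to `0`: at `k = 0` the factor `1 - t/p` vanishes at `t = p`.
  have key : ∀ k, p * (u ^ 2 * ((1 - b * v / a) * (1 - e * v / a) * (1 - g * v / a)) *
          (1 * jacksonTerm q a p b (q * u) v e g k) -
        v ^ 2 * ((1 - b * u / a) * (1 - e * u / a) * (1 - g * u / a)) *
          (1 * jacksonTerm q a p b u (q * v) e g k)) =
      u * v * (v - u) * ((if k = 0 then 0 else G (k - 1)) - G k) := by
    intro k
    have hX : ∀ u : ℂ, nodeFactor q a k p (q * u) =
        (1 - p * q ^ k / u) * qFac q (p * q ^ (k + 1) / u) * qPoch q (p * (q * u) / a) k := by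
      intro u
      rw [nodeFactor, show p * q ^ (k + 1) / (q * u) = p * q ^ k / u by
        rw [pow_succ]; field_simp,
        qFac_eq_one_sub_mul hq (p * q ^ k / u)]
      ring_nf
    rcases k with _ | k
    · have h0 := vwp_identity_start ha hp hu hv he hg hb
      simp only [jacksonTerm, hX, hG]
      simp only [nodeFactor, qPoch_zero, pow_zero, zero_add, pow_one, if_true, mul_one, one_mul]
      linear_combination (1 - p ^ 2 / a) * qFac q (p * q / p) * qFac q (p * q / b) *
        qFac q (p * q / e) * qFac q (p * q / g) * qFac q (p * q / u) * qFac q (p * q / v) * h0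
    · have h0 := vwp_identity (t := p * q ^ (k + 1)) ha hp hu hv he hg hb
      have hY : ∀ u : ℂ, nodeFactor q a (k + 1) p u = (1 - p * u / a) *
          (qFac q (p * q ^ (k + 1 + 1) / u) * qPoch q (p * (q * u) / a) k) := by
        intro u
        rw [nodeFactor, qPoch_succ']
        ring_nf
      have hZ : ∀ u : ℂ, qPoch q (p * (q * u) / a) (k + 1) =
          qPoch q (p * (q * u) / a) k * (1 - p * q ^ (k + 1) * u / a) := by
        intro u
        rw [qPoch_succ]
        ring_nf
      have hW : ∀ u : ℂ, nodeFactor q a k p u * (1 - p * q ^ k * u / a) =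
          (1 - p * q ^ (k + 1) / u) * nodeFactor q a (k + 1) p u := by
        intro u
        rw [← nodeFactor_telescope, nodeFactor_eq_one_sub_mul hq]
      have hV : ∀ u : ℂ, qFac q (p * q ^ (k + 1) / u) =
          (1 - p * q ^ (k + 1) / u) * qFac q (p * q ^ (k + 1 + 1) / u) := by
        intro u
        rw [qFac_eq_one_sub_mul hq]
        ring_nf
      have hGk : G k = (nodeFactor q a k p p * (1 - p * q ^ k * p / a)) *
          (nodeFactor q a k p b * (1 - p * q ^ k * b / a)) *
          (nodeFactor q a k p e * (1 - p * q ^ k * e / a)) *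
          (nodeFactor q a k p g * (1 - p * q ^ k * g / a)) *
          (qFac q (p * q ^ (k + 1) / u) * qPoch q (p * (q * u) / a) k) *
          (qFac q (p * q ^ (k + 1) / v) * qPoch q (p * (q * v) / a) k) := by
        simp only [hG]; ring
      simp only [Nat.add_eq_zero_iff, one_ne_zero, and_false, if_false, Nat.add_sub_cancel]
      rw [hGk, hW, hW, hW, hW, hV u, hV v]
      simp only [jacksonTerm, hX, hG, hZ, hY u, hY v]
      linear_combination nodeFactor q a (k + 1) p p * nodeFactor q a (k + 1) p b *
        nodeFactor q a (k + 1) p e * nodeFactor q a (k + 1) p g *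
        (qFac q (p * q ^ (k + 1 + 1) / u) * qPoch q (p * (q * u) / a) k) *
        (qFac q (p * q ^ (k + 1 + 1) / v) * qPoch q (p * (q * v) / a) k) * h0
  have hGlim : Tendsto G atTop (𝓝 (qFac q (p * p / a) * qFac q (p * b / a) * qFac q (p * e / a) *
      qFac q (p * g / a) * qFac q (p * (q * u) / a) * qFac q (p * (q * v) / a))) := by
    have h1 : ∀ w : ℂ, Tendsto (fun k : ℕ => 1 - p * q ^ k * w / a) atTop (𝓝 1) := by
      intro w
      have := (((tendsto_pow_atTop_nhds_zero_of_norm_lt_one hq).const_mul p).mul_const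
        (w / a)).const_sub 1
      simpa [mul_div_assoc] using this
    have h2 : ∀ w : ℂ, Tendsto (fun k : ℕ => qFac q (p * q ^ (k + 1) / w) *
        qPoch q (p * (q * w) / a) k) atTop (𝓝 (qFac q (p * (q * w) / a))) := by
      intro w
      have := ((tendsto_qFac_mul_pow hq (p / w)).comp (tendsto_add_atTop_nat 1)).mul
        (tendsto_qPoch hq (p * (q * w) / a))
      rw [one_mul] at this
      refine this.congr fun k => ?_
      simp only [Function.comp]
      ring_nf
    have h3 := tendsto_nodeFactor hq a p
    have := ((((((h3 p).mul (h3 b)).mul (h3 e)).mul (h3 g)).mul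
      ((((h1 p).mul (h1 b)).mul (h1 e)).mul (h1 g))).mul (h2 u)).mul (h2 v)
    simpa using this
  have hpart : ∀ n, ∑ k ∈ Finset.range n, ((if k = 0 then 0 else G (k - 1)) - G k) =
      if n = 0 then 0 else -G (n - 1) := by
    intro n
    induction n with
    | zero => simp
    | succ n ih =>
      rw [Finset.sum_range_succ, ih]
      rcases n with _ | n
      · simp
      · simp only [Nat.add_eq_zero_iff, one_ne_zero, and_false, if_false, Nat.add_sub_cancel]
        ring
  have hlim := hs.tendsto_sum_nat
  simp only [key, ← Finset.mul_sum, hpart] at hlim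
  have hlim2 : Tendsto (fun n : ℕ => u * v * (v - u) * (if n = 0 then 0 else -G (n - 1))) atTop
      (𝓝 (u * v * (v - u) * -(qFac q (p * p / a) * qFac q (p * b / a) * qFac q (p * e / a) *
      qFac q (p * g / a) * qFac q (p * (q * u) / a) * qFac q (p * (q * v) / a)))) := by
    refine Tendsto.const_mul _ ?_
    rw [← tendsto_add_atTop_iff_nat 1]
    simpa using hGlim.neg
  have := tendsto_nhds_unique hlim hlim2
  simp only [jacksonSeries]
  rw [this]
  ring

/-! ### The nonterminating balanced very-well-poised sum. -/

/-- The well-poised bilinear form of two Jackson series that represents the one-dimensional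
Jackson integral from `p` to `b` with weight `m`, after its denominators are cleared. -/
noncomputable def jacksonForm (q a : ℂ) (m : ℂ → ℂ) (p b c d e g : ℂ) : ℂ :=
  b * jacksonSeries q a m b p c d e g * (qFac q (p * p / a) * (qFac q (p * c / a) *
      qFac q (p * d / a) * qFac q (p * e / a) * qFac q (p * g / a))) -
    p * jacksonSeries q a m p b c d e g * (qFac q (b * b / a) * (qFac q (b * c / a) *
      qFac q (b * d / a) * qFac q (b * e / a) * qFac q (b * g / a)))

/-- The factor of the product side that depends on how the parameters are paired. -/
noncomputable def pairFactor (q a c d e g : ℂ) : ℂ :=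
  qFac q (a * q / (c * e)) * qFac q (a * q / (c * g)) * qFac q (a * q / (d * e)) *
    qFac q (a * q / (d * g))

/-- The factor of the product side that depends on the endpoints. -/
noncomputable def endFactor (q a p b : ℂ) : ℂ :=
  b * (qFac q q * qFac q (p / b) * qFac q (q * b / p) * qFac q (p * p / a) * qFac q (b * b / a))

/-- The quotient `Φ / w` is invariant under `z → qz`, so its maximum modulus on the closed
fundamental annulus bounds it on a larger open annulus. The maximum is then interior and the
quotient is locally constant. The identity theorem carries `Φ = const * w` to the whole punctured
plane, including the zeros of `w`. -/
theorem qPeriodic_ratio_const {q : ℂ} (hq : ‖q‖ < 1) (hq0 : q ≠ 0) {Φ w : ℂ → ℂ}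
    (hΦ : DifferentiableOn ℂ Φ {0}ᶜ) (hw : DifferentiableOn ℂ w {0}ᶜ)
    (hper : ∀ z, z ≠ 0 → Φ (q * z) * w z = Φ z * w (q * z))
    (hw0 : ∀ z, ‖q‖ ^ 2 < ‖z‖ → ‖z‖ < ‖q‖⁻¹ → w z ≠ 0) {z : ℂ} (hz : z ≠ 0) :
    Φ z * w 1 = Φ 1 * w z := by
  have hqp : 0 < ‖q‖ := norm_pos_iff.mpr hq0
  have hq2 : ‖q‖ ^ 2 < ‖q‖ := by nlinarith
  have hq3 : 1 < ‖q‖⁻¹ := (one_lt_inv₀ hqp).mpr hq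
  set U : Set ℂ := {z | ‖q‖ ^ 2 < ‖z‖ ∧ ‖z‖ < ‖q‖⁻¹} with hU
  have hUo : IsOpen U := (isOpen_lt continuous_const continuous_norm).inter
    (isOpen_lt continuous_norm continuous_const)
  have hU0 : U ⊆ {0}ᶜ := fun z hz => by
    have : 0 < ‖z‖ := lt_trans (by positivity) hz.1
    simpa using this
  set φ : ℂ → ℂ := fun z => Φ z / w z with hφ
  have hφd : DifferentiableOn ℂ φ U := (hΦ.mono hU0).div (hw.mono hU0) fun z hz => hw0 z hz.1 hz.2
  have hφper : ∀ z ∈ U, q * z ∈ U → φ (q * z) = φ z := fun z hz hqz => by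
    simp only [hφ]
    rw [div_eq_div_iff (hw0 _ hqz.1 hqz.2) (hw0 _ hz.1 hz.2)]
    exact hper z (hU0 hz)
  set K : Set ℂ := Metric.closedBall 0 1 ∩ {z | ‖q‖ ≤ ‖z‖} with hK
  have hKc : IsCompact K := (isCompact_closedBall _ _).inter_right
    (isClosed_le continuous_const continuous_norm)
  have hKU : K ⊆ U := fun z hz => by
    have h1 : ‖z‖ ≤ 1 := by simpa using hz.1
    exact ⟨hq2.trans_le hz.2, h1.trans_lt hq3⟩
  have h1K : (1 : ℂ) ∈ K := ⟨by simp, by simpa using hq.le⟩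
  obtain ⟨z₀, hz₀, hmax⟩ := hKc.exists_isMaxOn ⟨1, h1K⟩ (hφd.continuousOn.mono hKU).norm
  have hz₀U := hKU hz₀
  -- One multiplication by `q` or `q⁻¹` brings any point of `U` into `K`; this fixes the radii of
  -- `U`.
  have hle : ∀ z ∈ U, ‖φ z‖ ≤ ‖φ z₀‖ := by
    intro z hz
    have hzn := hz.1
    have hzn' := hz.2
    rcases le_or_gt ‖z‖ 1 with h1 | h1
    · rcases le_or_gt ‖q‖ ‖z‖ with h2 | h2
      · exact hmax (show z ∈ K from ⟨by simpa using h1, h2⟩)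
      · have hzq : q⁻¹ * z ∈ K := by
          refine ⟨?_, ?_⟩
          · simp only [mem_closedBall_zero_iff, norm_mul, norm_inv]
            rw [inv_mul_le_one₀ hqp]
            exact h2.le
          · simp only [Set.mem_ofPred_eq, norm_mul, norm_inv]
            rw [le_inv_mul_iff₀ hqp]
            nlinarith
        have := hφper (q⁻¹ * z) (hKU hzq) (by rwa [mul_inv_cancel_left₀ hq0])
        rw [mul_inv_cancel_left₀ hq0] at this
        rw [this]
        exact hmax hzq
    · have hzq : q * z ∈ K := by
        refine ⟨?_, ?_⟩
        · simp only [mem_closedBall_zero_iff, norm_mul]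
          rw [mul_comm, ← le_div_iff₀ hqp, one_div]
          exact hzn'.le
        · simp only [Set.mem_ofPred_eq, norm_mul]
          nlinarith
      rw [← hφper z hz (hKU hzq)]
      exact hmax hzq
  have hloc : ∀ᶠ y in 𝓝 z₀, φ y = φ z₀ := by
    refine Complex.eventually_eq_of_isLocalMax_norm ?_ ?_
    · filter_upwards [hUo.mem_nhds hz₀U] with y hy using hφd.differentiableAt (hUo.mem_nhds hy)
    · filter_upwards [hUo.mem_nhds hz₀U] with y hy using hle y hy
  have hopen : IsOpen ({0}ᶜ : Set ℂ) := isOpen_compl_singleton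
  have hpre : IsPreconnected ({0}ᶜ : Set ℂ) :=
    (isConnected_compl_singleton_of_one_lt_rank (by simp) 0).isPreconnected
  have heq := (hΦ.analyticOnNhd hopen).eqOn_of_preconnected_of_eventuallyEq
    ((hw.const_mul (φ z₀)).analyticOnNhd hopen) hpre (hU0 hz₀U) (by
      filter_upwards [hUo.mem_nhds hz₀U, hloc] with y hy hy'
      rw [← hy']
      exact (div_mul_cancel₀ _ (hw0 y hy.1 hy.2)).symm)
  have hz' := heq (show z ∈ ({0}ᶜ : Set ℂ) from hz)
  have h1' := heq (show (1 : ℂ) ∈ ({0}ᶜ : Set ℂ) by simp)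
  simp only at hz' h1'
  rw [hz', h1']
  ring

section
variable {q : ℂ} (hq : ‖q‖ < 1)
include hq

/-- In `jacksonSeries_contiguous` the boundary term at `p`, multiplied by the products attached to
`b`, is symmetric in `p` and `b`. The antisymmetric combination in `jacksonForm` cancels it, leaving
a homogeneous relation. -/
theorem jacksonForm_contiguous (hq0 : q ≠ 0) {a p b u v e g : ℂ}
    (ha : a ≠ 0) (hp : p ≠ 0) (hb : b ≠ 0) (hu : u ≠ 0) (hv : v ≠ 0) (he : e ≠ 0) (hg : g ≠ 0)
    (hbal : p * b * u * v * e * g = a ^ 3) :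
    jacksonForm q a (fun _ => 1) p b (q * u) v e g *
        (u ^ 2 * ((1 - e * v / a) * (1 - g * v / a))) =
      jacksonForm q a (fun _ => 1) p b u (q * v) e g *
        (v ^ 2 * ((1 - e * u / a) * (1 - g * u / a))) := by
  have h1 := jacksonSeries_contiguous hq hq0 ha hp hu hv he hg hbal
  have h2 := jacksonSeries_contiguous hq hq0 (p := b) (b := p) ha hb hu hv he hg
    (by rw [← hbal]; ring)
  have hF : ∀ x w : ℂ, qFac q (x * w / a) = (1 - w * x / a) * qFac q (x * (q * w) / a) := by
    intro x w
    rw [qFac_eq_one_sub_mul hq (x * w / a)]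
    ring_nf
  simp only [jacksonForm]
  rw [hF p v, hF b v, hF p u, hF b u]
  rw [mul_comm b p] at h2
  linear_combination (qFac q (p * p / a) * qFac q (p * (q * u) / a) * qFac q (p * (q * v) / a) *
      qFac q (p * e / a) * qFac q (p * g / a)) * h2 -
    (qFac q (b * b / a) * qFac q (b * (q * u) / a) * qFac q (b * (q * v) / a) *
      qFac q (b * e / a) * qFac q (b * g / a)) * h1

/-- Each shift in `pairFactor` produces a factor `1 - a/(xw) = -(a/(xw))(1 - xw/a)`. These reproduce
the coefficients of `jacksonForm_contiguous`, including `u²` and `v²`. -/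
theorem jacksonForm_mul_pairFactor (hq0 : q ≠ 0) {a p b u v e g : ℂ}
    (ha : a ≠ 0) (hp : p ≠ 0) (hb : b ≠ 0) (hu : u ≠ 0) (hv : v ≠ 0) (he : e ≠ 0) (hg : g ≠ 0)
    (hbal : p * b * u * v * e * g = a ^ 3) :
    jacksonForm q a (fun _ => 1) p b (q * u) v e g * pairFactor q a u (q * v) e g =
      jacksonForm q a (fun _ => 1) p b u (q * v) e g * pairFactor q a (q * u) v e g := by
  have h := jacksonForm_contiguous hq hq0 ha hp hb hu hv he hg hbal
  have hF : ∀ x w : ℂ, x ≠ 0 → w ≠ 0 → qFac q (a * q / (q * x * w)) =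
      -(a / (x * w)) * (1 - w * x / a) * qFac q (a * q / (x * w)) := by
    intro x w hx hw
    rw [show a * q / (q * x * w) = a / (x * w) by field_simp,
      qFac_eq_one_sub_mul hq (a / (x * w)), show a / (x * w) * q = a * q / (x * w) by ring]
    congr 1
    field_simp
    ring
  simp only [pairFactor]
  rw [hF u e hu he, hF u g hu hg, hF v e hv he, hF v g hv hg]
  have h' := congrArg (fun z => z * (a ^ 2 / (u ^ 2 * v ^ 2 * e * g))) h
  simp only at h'
  have e1 : a ^ 2 / (u ^ 2 * v ^ 2 * e * g) * u ^ 2 = (a / (v * e)) * (a / (v * g)) := by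
    field_simp
  have e2 : a ^ 2 / (u ^ 2 * v ^ 2 * e * g) * v ^ 2 = (a / (u * e)) * (a / (u * g)) := by
    field_simp
  generalize jacksonForm q a (fun _ => 1) p b (q * u) v e g = X at *
  generalize jacksonForm q a (fun _ => 1) p b u (q * v) e g = Y at *
  generalize qFac q (a * q / (u * e)) = A at *
  generalize qFac q (a * q / (u * g)) = B at *
  generalize qFac q (a * q / (v * e)) = C at *
  generalize qFac q (a * q / (v * g)) = D at *
  linear_combination (A * B * C * D) * h' -
    (A * B * C * D * X * ((1 - e * v / a) * (1 - g * v / a))) * e1 +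
    (A * B * C * D * Y * ((1 - e * u / a) * (1 - g * u / a))) * e2

/-- At `p c = a` the factor `(pc/a; q)_∞ = (1; q)_∞` removes the series based at `b`, and `(1; q)_k
= 0` for `k ≥ 1` reduces the series based at `p` to its first term. -/
theorem jacksonForm_of_mul_eq {a p b c d e g : ℂ}
    (ha : a ≠ 0) (hp : p ≠ 0) (hb : b ≠ 0) (hd : d ≠ 0) (he : e ≠ 0)
    (hg : g ≠ 0) (hpc : p * c = a) (hbal : b * d * e * g = a ^ 2 * q) :
    jacksonForm q a (fun _ => 1) p b c d e g =
      endFactor q a p b * (qFac q (a * q / (c * d)) * qFac q (a * q / (e * g))) *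
        pairFactor q a c d e g := by
  have h1 : qFac q (p * c / a) = 0 := by rw [hpc, div_self ha, qFac_one hq]
  have hS : jacksonSeries q a (fun _ => 1) p b c d e g = jacksonTerm q a p b c d e g 0 := by
    rw [jacksonSeries, tsum_eq_single 0]
    · simp
    · intro k hk
      obtain ⟨k, rfl⟩ := Nat.exists_eq_succ_of_ne_zero hk
      have : nodeFactor q a (k + 1) p c = 0 := by
        rw [nodeFactor, hpc, div_self ha, qPoch_one_succ, mul_zero]
      simp [jacksonTerm, this]
  have hc : c ≠ 0 := by
    rintro rfl
    exact ha (by simpa using hpc.symm)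
  obtain rfl : a = p * c := hpc.symm
  have hq' : q = b * d * e * g / (p * c) ^ 2 := by
    rw [hbal]; field_simp
  have t1 : p * c * q / (c * e) = p * q / e := by field_simp
  have t2 : p * c * q / (c * g) = p * q / g := by field_simp
  have t3 : p * c * q / (c * d) = p * q / d := by field_simp
  have t4 : p * c * q / (d * e) = b * g / (p * c) := by
    field_simp; linear_combination -hbal
  have t5 : p * c * q / (d * g) = b * e / (p * c) := by
    field_simp; linear_combination -hbal
  have t6 : p * c * q / (e * g) = b * d / (p * c) := by
    field_simp; linear_combination -hbal
  have t7 : b * c / (p * c) = b / p := by field_simp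
  have t8 : p * q / c = p * p / (p * c) * q := by field_simp
  have f1 := qFac_eq_one_sub_mul hq (p / b)
  have f2 := qFac_eq_one_sub_mul hq (b / p)
  have f3 := qFac_eq_one_sub_mul hq (p * p / (p * c))
  rw [jacksonForm, h1, hS]
  simp only [jacksonTerm, nodeFactor, pairFactor, endFactor, qPoch_zero, pow_zero, zero_add,
    pow_one, mul_one, one_mul]
  rw [t1, t2, t3, t4, t5, t6, t7, t8, f1, f2, f3, show p * q / p = q by field_simp,
    show p / b * q = p * q / b by ring, show b / p * q = q * b / p by ring,
    show p * p / (p * c) = p ^ 2 / (p * c) by ring]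
  generalize qFac q (p * q / b) = x1
  generalize qFac q (q * b / p) = x2
  have e1 : b * (1 - p / b) = -(p * (1 - b / p)) := by field_simp; ring
  generalize qFac q q = y1
  generalize qFac q (p ^ 2 / (p * c) * q) = y2
  generalize qFac q (p * q / d) = y3
  generalize qFac q (p * q / e) = y4
  generalize qFac q (p * q / g) = y5
  generalize qFac q (b * b / (p * c)) = y6
  generalize qFac q (b * d / (p * c)) = y7
  generalize qFac q (b * e / (p * c)) = y8
  generalize qFac q (b * g / (p * c)) = y9
  linear_combination (-(x1 * x2 * y1 * y2 * y3 * y4 * y5 * y6 * y7 * y8 * y9 *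
    (1 - p ^ 2 / (p * c)))) * e1

end

section
variable {q : ℂ} (hq : ‖q‖ < 1)
include hq

theorem DifferentiableOn.qFac_comp {u : ℂ → ℂ} {U : Set ℂ} (hu : DifferentiableOn ℂ u U) :
    DifferentiableOn ℂ (fun s => qFac q (u s)) U :=
  (differentiable_qFac hq).comp_differentiableOn hu

theorem differentiableOn_pairFactor (a : ℂ) {U : Set ℂ} {c d e g : ℂ → ℂ}
    (hc : DifferentiableOn ℂ c U) (hd : DifferentiableOn ℂ d U)
    (he : DifferentiableOn ℂ e U) (hg : DifferentiableOn ℂ g U)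
    (hc0 : ∀ s ∈ U, c s ≠ 0) (hd0 : ∀ s ∈ U, d s ≠ 0) (he0 : ∀ s ∈ U, e s ≠ 0)
    (hg0 : ∀ s ∈ U, g s ≠ 0) :
    DifferentiableOn ℂ (fun s => pairFactor q a (c s) (d s) (e s) (g s)) U := by
  have h : ∀ {u v : ℂ → ℂ}, DifferentiableOn ℂ u U → DifferentiableOn ℂ v U →
      (∀ s ∈ U, u s ≠ 0) → (∀ s ∈ U, v s ≠ 0) →
      DifferentiableOn ℂ (fun s => qFac q (a * q / (u s * v s))) U := fun hu hv hu0 hv0 =>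
    DifferentiableOn.qFac_comp hq
      ((differentiableOn_const _).div (hu.mul hv) fun s hs => mul_ne_zero (hu0 s hs) (hv0 s hs))
  exact (((h hc he hc0 he0).mul (h hc hg hc0 hg0)).mul (h hd he hd0 he0)).mul (h hd hg hd0 hg0)

theorem differentiableOn_jacksonForm {m : ℂ → ℂ} (hm : Differentiable ℂ m) (a : ℂ) {U : Set ℂ}
    (hU : IsOpen U) {p b c d e g : ℂ → ℂ} (hp : DifferentiableOn ℂ p U)
    (hb : DifferentiableOn ℂ b U) (hc : DifferentiableOn ℂ c U) (hd : DifferentiableOn ℂ d U)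
    (he : DifferentiableOn ℂ e U) (hg : DifferentiableOn ℂ g U)
    (hp0 : ∀ s ∈ U, p s ≠ 0) (hb0 : ∀ s ∈ U, b s ≠ 0) (hc0 : ∀ s ∈ U, c s ≠ 0)
    (hd0 : ∀ s ∈ U, d s ≠ 0) (he0 : ∀ s ∈ U, e s ≠ 0) (hg0 : ∀ s ∈ U, g s ≠ 0) :
    DifferentiableOn ℂ (fun s => jacksonForm q a m (p s) (b s) (c s) (d s) (e s) (g s)) U := by
  have h : ∀ {u v : ℂ → ℂ}, DifferentiableOn ℂ u U → DifferentiableOn ℂ v U →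
      DifferentiableOn ℂ (fun s => qFac q (u s * v s / a)) U := fun hu hv =>
    DifferentiableOn.qFac_comp hq ((hu.mul hv).div_const a)
  have h1 := differentiableOn_jacksonSeries hq hm a hU hb hp hc hd he hg hb0 hp0 hc0 hd0 he0 hg0
  have h2 := differentiableOn_jacksonSeries hq hm a hU hp hb hc hd he hg hp0 hb0 hc0 hd0 he0 hg0
  exact ((hb.mul h1).mul ((h hp hp).mul ((((h hp hc).mul (h hp hd)).mul (h hp he)).mul
    (h hp hg)))).sub ((hp.mul h2).mul ((h hb hb).mul ((((h hb hc).mul (h hb hd)).mul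
      (h hb he)).mul (h hb hg))))

/-- Apply `qPeriodic_ratio_const` along the curve `c = (a/p) z`, `d = D/z`, which keeps `c d` and
the balancing fixed. The point `z = 1` is the terminating case and `z = pc/a` is the given one. -/
theorem jacksonForm_eq_of_small (hq0 : q ≠ 0) {a p b c d e g : ℂ}
    (ha : a ≠ 0) (hp : p ≠ 0) (hb : b ≠ 0) (hc : c ≠ 0) (he : e ≠ 0) (hg : g ≠ 0)
    (hbal : p * b * c * d * e * g = a ^ 3 * q)
    (hpe : ‖p‖ ≤ ‖q‖ * ‖e‖) (hpg : ‖p‖ ≤ ‖q‖ * ‖g‖)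
    (hbe : ‖b * e / a‖ ≤ ‖q‖) (hbg : ‖b * g / a‖ ≤ ‖q‖) :
    jacksonForm q a (fun _ => 1) p b c d e g =
      endFactor q a p b * (qFac q (a * q / (c * d)) * qFac q (a * q / (e * g))) *
        pairFactor q a c d e g := by
  have hqp : 0 < ‖q‖ := norm_pos_iff.mpr hq0
  set D : ℂ := a ^ 2 * q / (b * e * g) with hD
  have hD0 : D ≠ 0 := by rw [hD]; positivity
  have hU : IsOpen ({0}ᶜ : Set ℂ) := isOpen_compl_singleton
  have hap : a / p ≠ 0 := div_ne_zero ha hp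
  have hcd : DifferentiableOn ℂ (fun z : ℂ => a / p * z) {0}ᶜ := by fun_prop
  have hdd : DifferentiableOn ℂ (fun z : ℂ => D / z) {0}ᶜ :=
    (differentiableOn_const _).div differentiableOn_id fun z hz => hz
  have hc0 : ∀ z ∈ ({0}ᶜ : Set ℂ), a / p * z ≠ 0 := fun z hz => mul_ne_zero hap hz
  have hd0 : ∀ z ∈ ({0}ᶜ : Set ℂ), D / z ≠ 0 := fun z hz => div_ne_zero hD0 hz
  have hratio := qPeriodic_ratio_const hq hq0
    (Φ := fun z => jacksonForm q a (fun _ => 1) p b (a / p * z) (D / z) e g)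
    (w := fun z => pairFactor q a (a / p * z) (D / z) e g)
    (differentiableOn_jacksonForm hq (differentiable_const _) a hU (differentiableOn_const p)
      (differentiableOn_const b) hcd hdd (differentiableOn_const e) (differentiableOn_const g)
      (fun _ _ => hp) (fun _ _ => hb) hc0 hd0 (fun _ _ => he) (fun _ _ => hg))
    (differentiableOn_pairFactor hq a hcd hdd (differentiableOn_const e)
      (differentiableOn_const g) hc0 hd0 (fun _ _ => he) (fun _ _ => hg))
    (fun z hz => by
      have h := jacksonForm_mul_pairFactor hq hq0 (u := a / p * z) (v := D / (q * z)) ha hp hb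
        (mul_ne_zero hap hz) (div_ne_zero hD0 (mul_ne_zero hq0 hz)) he hg (by
          rw [hD]; field_simp)
      rw [show q * (D / (q * z)) = D / z by field_simp,
        show q * (a / p * z) = a / p * (q * z) by ring] at h
      exact h)
    -- On this curve the arguments in `pairFactor` are `pq/(ez)`, `pq/(gz)`, `bgz/a` and `bez/a`.
    -- The four size hypotheses make them smaller than `1` in modulus on the annulus.
    (fun z hz1 hz2 => by
      have hz0 : 0 < ‖z‖ := lt_trans (by positivity) hz1
      have hz : z ≠ 0 := norm_pos_iff.mp hz0
      have h1 : ∀ w : ℂ, w ≠ 0 → ‖p‖ ≤ ‖q‖ * ‖w‖ → qFac q (a * q / (a / p * z * w)) ≠ 0 := by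
        intro w hw hpw
        refine qFac_ne_zero_of_norm_lt hq ?_
        have hw0 := norm_pos_iff.mpr hw
        rw [show a * q / (a / p * z * w) = p * q / (w * z) by field_simp, norm_div, norm_mul,
          norm_mul, div_lt_one (by positivity)]
        calc ‖p‖ * ‖q‖ ≤ ‖q‖ * ‖w‖ * ‖q‖ := by gcongr
          _ = ‖w‖ * ‖q‖ ^ 2 := by ring
          _ < ‖w‖ * ‖z‖ := by gcongr
      have h2 : ∀ w : ℂ, ‖w‖ ≤ ‖q‖ → qFac q (w * z) ≠ 0 := by
        intro w hw
        refine qFac_ne_zero_of_norm_lt hq ?_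
        rw [norm_mul]
        calc ‖w‖ * ‖z‖ ≤ ‖q‖ * ‖z‖ := by gcongr
          _ < ‖q‖ * ‖q‖⁻¹ := by gcongr
          _ = 1 := mul_inv_cancel₀ hqp.ne'
      have e1 : a * q / (D / z * e) = b * g / a * z := by rw [hD]; field_simp
      have e2 : a * q / (D / z * g) = b * e / a * z := by rw [hD]; field_simp
      simp only [pairFactor, e1, e2]
      exact mul_ne_zero (mul_ne_zero (mul_ne_zero (h1 e he hpe) (h1 g hg hpg)) (h2 _ hbg))
        (h2 _ hbe))
    (z := p * c / a) (by positivity)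
  have hw1 : pairFactor q a (a / p * 1) (D / 1) e g ≠ 0 := by
    have h1 : ∀ w : ℂ, w ≠ 0 → ‖p‖ ≤ ‖q‖ * ‖w‖ → qFac q (a * q / (a / p * 1 * w)) ≠ 0 := by
      intro w hw hpw
      refine qFac_ne_zero_of_norm_lt hq ?_
      have hw0 := norm_pos_iff.mpr hw
      rw [show a * q / (a / p * 1 * w) = p * q / w by field_simp, norm_div, norm_mul,
        div_lt_one (by positivity)]
      calc ‖p‖ * ‖q‖ ≤ ‖q‖ * ‖w‖ * ‖q‖ := by gcongr
        _ = ‖w‖ * ‖q‖ ^ 2 := by ring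
        _ < ‖w‖ * 1 := by
          gcongr
          exact pow_lt_one₀ hqp.le hq two_ne_zero
        _ = ‖w‖ := mul_one _
    have e1 : a * q / (D / 1 * e) = b * g / a := by rw [hD]; field_simp
    have e2 : a * q / (D / 1 * g) = b * e / a := by rw [hD]; field_simp
    simp only [pairFactor, e1, e2]
    exact mul_ne_zero (mul_ne_zero (mul_ne_zero (h1 e he hpe) (h1 g hg hpg))
      (qFac_ne_zero_of_norm_lt hq (hbg.trans_lt hq)))
      (qFac_ne_zero_of_norm_lt hq (hbe.trans_lt hq))
  have hval := jacksonForm_of_mul_eq hq (p := p) (c := a / p * 1) (d := D / 1) ha hp hb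
    (div_ne_zero hD0 one_ne_zero) he hg (by field_simp) (by rw [hD]; field_simp)
  have ec : a / p * (p * c / a) = c := by field_simp
  have ed : D / (p * c / a) = d := by
    rw [hD]
    field_simp
    linear_combination -hbal
  have ecd : a / p * 1 * (D / 1) = c * d := by
    rw [hD]
    field_simp
    linear_combination -hbal
  simp only [ec, ed] at hratio
  rw [hval, ecd] at hratio
  refine mul_right_cancel₀ hw1 (hratio.trans ?_)
  ring

/-- The nonterminating very-well-poised balanced `₈φ₇` sum, with denominators cleared. -/
theorem jacksonForm_eq (hq0 : q ≠ 0) {a p b c d e g : ℂ}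
    (ha : a ≠ 0) (hp : p ≠ 0) (hb : b ≠ 0) (hc : c ≠ 0) (hd : d ≠ 0) (he : e ≠ 0) (hg : g ≠ 0)
    (hbal : p * b * c * d * e * g = a ^ 3 * q) :
    jacksonForm q a (fun _ => 1) p b c d e g =
      endFactor q a p b * (qFac q (a * q / (c * d)) * qFac q (a * q / (e * g))) *
        pairFactor q a c d e g := by
  have hqp : 0 < ‖q‖ := norm_pos_iff.mpr hq0
  have hU : IsOpen ({0}ᶜ : Set ℂ) := isOpen_compl_singleton
  have hpre : IsPreconnected ({0}ᶜ : Set ℂ) :=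
    (isConnected_compl_singleton_of_one_lt_rank (by simp) 0).isPreconnected
  -- The deformation `p → sp`, `b → sb`, `d → d/s²` preserves the balancing, and for small `s` it
  -- satisfies the size hypotheses of `jacksonForm_eq_of_small`. Both sides are holomorphic for `s ≠
  -- 0`, and `s = 1` is the claim.
  have hpd : DifferentiableOn ℂ (fun s : ℂ => s * p) {0}ᶜ := by fun_prop
  have hbd : DifferentiableOn ℂ (fun s : ℂ => s * b) {0}ᶜ := by fun_prop
  have hdd : DifferentiableOn ℂ (fun s : ℂ => d / s ^ 2) {0}ᶜ :=
    (differentiableOn_const _).div (by fun_prop) fun s hs => pow_ne_zero 2 hs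
  have hp0 : ∀ s ∈ ({0}ᶜ : Set ℂ), s * p ≠ 0 := fun s hs => mul_ne_zero hs hp
  have hb0 : ∀ s ∈ ({0}ᶜ : Set ℂ), s * b ≠ 0 := fun s hs => mul_ne_zero hs hb
  have hd0 : ∀ s ∈ ({0}ᶜ : Set ℂ), d / s ^ 2 ≠ 0 := fun s hs => div_ne_zero hd (pow_ne_zero 2 hs)
  have hL := differentiableOn_jacksonForm hq (differentiable_const 1) a hU hpd hbd
    (differentiableOn_const c) hdd (differentiableOn_const e) (differentiableOn_const g)
    hp0 hb0 (fun _ _ => hc) hd0 (fun _ _ => he) (fun _ _ => hg)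
  have hR : DifferentiableOn ℂ (fun s => endFactor q a (s * p) (s * b) *
      (qFac q (a * q / (c * (d / s ^ 2))) * qFac q (a * q / (e * g))) *
        pairFactor q a c (d / s ^ 2) e g) {0}ᶜ := by
    refine (DifferentiableOn.mul ?_ ?_).mul (differentiableOn_pairFactor hq a
      (differentiableOn_const c) hdd (differentiableOn_const e) (differentiableOn_const g)
      (fun _ _ => hc) hd0 (fun _ _ => he) (fun _ _ => hg))
    · have h1 := DifferentiableOn.qFac_comp hq (hpd.div hbd hb0)
      have h2 := DifferentiableOn.qFac_comp hq ((hbd.const_mul q).div hpd hp0)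
      have h3 := DifferentiableOn.qFac_comp hq ((hpd.mul hpd).div_const a)
      have h4 := DifferentiableOn.qFac_comp hq ((hbd.mul hbd).div_const a)
      exact hbd.mul ((((h1.const_mul (qFac q q)).mul h2).mul h3).mul h4)
    · exact (DifferentiableOn.qFac_comp hq ((differentiableOn_const (a * q)).div
        (hdd.const_mul c) fun s hs => mul_ne_zero hc (hd0 s hs))).mul_const _
  have hsmall : ∀ᶠ s in 𝓝 (0 : ℂ), ‖s * p‖ < ‖q‖ * ‖e‖ ∧ ‖s * p‖ < ‖q‖ * ‖g‖ ∧
      ‖s * b * e / a‖ < ‖q‖ ∧ ‖s * b * g / a‖ < ‖q‖ := by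
    have h : ∀ {f : ℂ → ℂ} {r : ℝ}, Continuous f → f 0 = 0 → 0 < r → ∀ᶠ s in 𝓝 (0 : ℂ),
        ‖f s‖ < r := fun hf h0 hr => by
      have := hf.norm.tendsto 0
      rw [h0, norm_zero] at this
      exact this.eventually_lt_const hr
    have he' := norm_pos_iff.mpr he
    have hg' := norm_pos_iff.mpr hg
    refine (h (by fun_prop) (by simp) (by positivity)).and ((h (by fun_prop) (by simp)
      (by positivity)).and ((h (by fun_prop) (by simp) hqp).and
        (h (by fun_prop) (by simp) hqp)))
  obtain ⟨V, hV, hVo, h0V⟩ := eventually_nhds_iff.mp hsmall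
  obtain ⟨s₀, hs₀V, hs₀⟩ : ∃ s₀ ∈ V, s₀ ≠ (0 : ℂ) := by
    have : (V ∩ {0}ᶜ : Set ℂ).Nonempty :=
      (dense_compl_singleton (0 : ℂ)).inter_open_nonempty V hVo ⟨0, h0V⟩
    obtain ⟨s, hs, hs'⟩ := this
    exact ⟨s, hs, hs'⟩
  have heq := (hL.analyticOnNhd hU).eqOn_of_preconnected_of_eventuallyEq
    (hR.analyticOnNhd hU) hpre (show s₀ ∈ ({0}ᶜ : Set ℂ) from hs₀) (by
      filter_upwards [hVo.mem_nhds hs₀V, hU.mem_nhds hs₀] with s hs hs'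
      obtain ⟨h1, h2, h3, h4⟩ := hV s hs
      have hs0 : s ≠ 0 := hs'
      exact jacksonForm_eq_of_small hq hq0 ha (hp0 s hs') (hb0 s hs') hc he hg
        (by rw [← hbal]; field_simp) h1.le h2.le h3.le h4.le)
  have := heq (show (1 : ℂ) ∈ ({0}ᶜ : Set ℂ) by simp)
  simpa using this

end

/-! ### The determinant of a basis of split polynomials. -/

/-- The product of linear factors with roots `α 0, …, α (j - 1)` and `β 0, …, β (n - 2 - j)`. -/
noncomputable def splitPoly (α β : ℕ → ℂ) (n j : ℕ) : Polynomial ℂ :=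
  (∏ l ∈ Finset.range j, (Polynomial.X - Polynomial.C (α l))) *
    ∏ m ∈ Finset.range (n - 1 - j), (Polynomial.X - Polynomial.C (β m))

/-- The determinant of the coefficients of the polynomials `splitPoly α β n j`, `j < n`. -/
def splitConst (α β : ℕ → ℂ) (n : ℕ) : ℂ :=
  ∏ k ∈ Finset.range n, ∏ j ∈ Finset.range k, (β (k - 1 - j) - α j)

theorem splitPoly_monic (α β : ℕ → ℂ) (n j : ℕ) : (splitPoly α β n j).Monic :=
  (Polynomial.monic_prod_of_monic _ _ fun _ _ => Polynomial.monic_X_sub_C _).mul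
    (Polynomial.monic_prod_of_monic _ _ fun _ _ => Polynomial.monic_X_sub_C _)

theorem splitPoly_natDegree (α β : ℕ → ℂ) {n j : ℕ} (hj : j < n) :
    (splitPoly α β n j).natDegree = n - 1 := by
  rw [splitPoly, Polynomial.Monic.natDegree_mul
    (Polynomial.monic_prod_of_monic _ _ fun _ _ => Polynomial.monic_X_sub_C _)
    (Polynomial.monic_prod_of_monic _ _ fun _ _ => Polynomial.monic_X_sub_C _),
    Polynomial.natDegree_finsetProd_X_sub_C_eq_card,
    Polynomial.natDegree_finsetProd_X_sub_C_eq_card]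
  simp only [Finset.card_range]
  omega

theorem splitPoly_succ (α β : ℕ → ℂ) {n j : ℕ} (hj : j < n) :
    splitPoly α β (n + 1) (j + 1) =
      Polynomial.C (β (n - 1 - j) - α j) * splitPoly α β n j + splitPoly α β (n + 1) j := by
  have h1 : n + 1 - 1 - (j + 1) = n - 1 - j := by omega
  have h2 : n + 1 - 1 - j = n - 1 - j + 1 := by omega
  simp only [splitPoly, h1, h2, Finset.prod_range_succ, map_sub]
  ring

/-- Neighbouring polynomials share all but one factor, so subtracting adjacent columns gives
multiples of the polynomials of one degree less. The coefficients are listed from the top degree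
down. After the subtraction the first row is therefore `(1, 0, …, 0)`, and expansion along it gives
the induction. -/
theorem det_coeff_splitPoly (α β : ℕ → ℂ) (n : ℕ) :
    (Matrix.of fun k j : Fin n => (splitPoly α β n j).coeff (n - 1 - k)).det =
      splitConst α β n := by
  induction n with
  | zero => simp [splitConst]
  | succ n ih =>
    set B : Matrix (Fin (n + 1)) (Fin (n + 1)) ℂ := Matrix.of fun k j =>
      Fin.cases ((splitPoly α β (n + 1) 0).coeff (n - k))
        (fun j : Fin n => (β (n - 1 - j) - α j) * (splitPoly α β n j).coeff (n - k)) j with hB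
    rw [Matrix.det_eq_of_forall_col_eq_smul_add_pred (B := B) (fun _ => 1)
      (fun k => by simp [hB])
      (fun k j => by
        simp only [hB, Matrix.of_apply, Fin.val_succ, Fin.val_castSucc, Fin.cases_succ, one_mul,
          Nat.add_sub_cancel]
        rw [splitPoly_succ α β j.2, Polynomial.coeff_add, Polynomial.coeff_C_mul]),
      Matrix.det_succ_row_zero, Fin.sum_univ_succ]
    have h0 : B 0 0 = 1 := by
      have h1 := splitPoly_monic α β (n + 1) 0
      have h2 := splitPoly_natDegree α β (Nat.succ_pos n)
      rw [Polynomial.Monic, Polynomial.leadingCoeff, h2] at h1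
      simpa [hB] using h1
    have hs : ∀ j : Fin n, B 0 j.succ = 0 := fun j => by
      have h2 := splitPoly_natDegree α β j.2
      have hj := j.2
      have : (splitPoly α β n j).coeff n = 0 :=
        Polynomial.coeff_eq_zero_of_natDegree_lt (by omega)
      simp [hB, this]
    have hsub : B.submatrix (Fin.succ) (Fin.succAbove 0) = Matrix.of fun k j : Fin n =>
        (β (n - 1 - j) - α j) * (splitPoly α β n j).coeff (n - 1 - k) := by
      ext k j
      have : n - (k + 1 : ℕ) = n - 1 - k := by omega
      simp [hB, this]
    rw [hsub, h0]
    simp only [hs]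
    have hdet := Matrix.det_mul_row (fun j : Fin n => β (n - 1 - j) - α j)
      (Matrix.of fun k j : Fin n => (splitPoly α β n j).coeff (n - 1 - k))
    simp only [Matrix.of_apply] at hdet
    rw [hdet, ih, splitConst, splitConst, Finset.prod_range_succ,
      ← Fin.prod_univ_eq_prod_range (fun j => β (n - 1 - j) - α j) n]
    simp [mul_comm]

theorem splitPoly_eval (α β : ℕ → ℂ) {n j : ℕ} (hj : j < n) (T : ℂ) :
    (splitPoly α β n j).eval T =
      ∑ k : Fin n, T ^ (n - 1 - k : ℕ) * (splitPoly α β n j).coeff (n - 1 - k) := by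
  rw [Polynomial.eval_eq_sum_range' (n := n) (by rw [splitPoly_natDegree α β hj]; omega),
    Fin.sum_univ_eq_sum_range
      (fun k => T ^ (n - 1 - k) * (splitPoly α β n j).coeff (n - 1 - k)),
    Finset.sum_range_reflect (fun k => T ^ k * (splitPoly α β n j).coeff k)]
  exact Finset.sum_congr rfl fun k _ => mul_comm _ _

/-! ### Multiple Jackson integrals of determinants. -/

theorem hasSum_prod_pi {r : ℕ} (φ : Fin r → ℕ → ℂ) (h : ∀ i, Summable fun k => ‖φ i k‖) :
    (Summable fun k : Fin r → ℕ => ‖∏ i, φ i (k i)‖) ∧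
      HasSum (fun k : Fin r → ℕ => ∏ i, φ i (k i)) (∏ i, ∑' k, φ i k) := by
  induction r with
  | zero => exact ⟨Summable.of_finite, by simp⟩
  | succ r ih =>
    obtain ⟨h1, h2⟩ := ih (fun i => φ i.succ) fun i => h i.succ
    have hs := Summable.mul_norm (h 0) h1
    have hp := tsum_mul_tsum_of_summable_norm (h 0) h1
    have he : ∀ x : ℕ × (Fin r → ℕ), ∏ i, φ i (Fin.consEquiv (fun _ => ℕ) x i) =
        φ 0 x.1 * ∏ i, φ i.succ (x.2 i) := fun x => by
      simp [Fin.prod_univ_succ, Fin.consEquiv]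
    constructor
    · rw [← (Fin.consEquiv fun _ => ℕ).summable_iff]
      refine hs.congr fun x => ?_
      rw [Function.comp_apply, he]
    · rw [← (Fin.consEquiv fun _ => ℕ).hasSum_iff]
      have : HasSum (fun x : ℕ × (Fin r → ℕ) => φ 0 x.1 * ∏ i, φ i.succ (x.2 i))
          (∏ i, ∑' k, φ i k) := by
        rw [Fin.prod_univ_succ, ← h2.tsum_eq, hp]
        exact (Summable.of_norm hs).hasSum
      exact this.congr_fun he

/-- The unnormalised one-dimensional Jackson integral `∫_α^β h(t) d_q t / (1 - q)`. -/
noncomputable def jacksonInt (q α β : ℂ) (h : ℂ → ℂ) : ℂ :=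
  β * ∑' k : ℕ, h (β * q ^ k) * q ^ k - α * ∑' k : ℕ, h (α * q ^ k) * q ^ k

/-- In the Leibniz expansion every term is a product of functions of one variable each, so its
multiple series factors. The sum over `S` is the expansion of a product of differences of endpoint
contributions. -/
theorem qIntegral_det {r : ℕ} (q C : ℂ) (α β : Fin r → ℂ) (h : Fin r → Fin r → ℂ → ℂ)
    (hα : ∀ i l, Summable fun k : ℕ => h i l (α i * q ^ k) * q ^ k)
    (hβ : ∀ i l, Summable fun k : ℕ => h i l (β i * q ^ k) * q ^ k) :
    QIntegrable q α β (fun t => C * (Matrix.of fun i l => h i l (t i)).det) ∧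
      qIntegral q α β (fun t => C * (Matrix.of fun i l => h i l (t i)).det) =
        (1 - q) ^ r * C * (Matrix.of fun i l => jacksonInt q (α i) (β i) (h i l)).det := by
  set X : Finset (Fin r) → Fin r → Fin r → ℂ := fun S i l =>
    ∑' k : ℕ, h i l ((if i ∈ S then α i else β i) * q ^ k) * q ^ k with hX
  have hX1 : ∀ S i l, i ∈ S → X S i l = ∑' k : ℕ, h i l (α i * q ^ k) * q ^ k := by
    intro S i l hi
    simp [hX, hi]
  have hX2 : ∀ S i l, i ∉ S → X S i l = ∑' k : ℕ, h i l (β i * q ^ k) * q ^ k := by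
    intro S i l hi
    simp [hX, hi]
  have hsum : ∀ S : Finset (Fin r), HasSum (qIntegralTerm q α β
      (fun t => C * (Matrix.of fun i l => h i l (t i)).det) S)
      (C * (Matrix.of fun i l => X S i l).det) := by
    intro S
    have h1 : ∀ σ : Equiv.Perm (Fin r), HasSum (fun k : Fin r → ℕ =>
        ∏ i, (h i (σ i) (qNode q α β S k i) * q ^ k i)) (∏ i, X S i (σ i)) := by
      intro σ
      refine (hasSum_prod_pi (fun i k =>
        h i (σ i) ((if i ∈ S then α i else β i) * q ^ k) * q ^ k) fun i => ?_).2
      by_cases hi : i ∈ S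
      · simpa only [hi, if_true] using (hα i (σ i)).norm
      · simpa only [hi, if_false] using (hβ i (σ i)).norm
    have h2 := (hasSum_sum (s := Finset.univ) fun (σ : Equiv.Perm (Fin r)) _ =>
      (h1 σ).mul_left ((Equiv.Perm.sign σ : ℤ) : ℂ)).mul_left C
    rw [← Matrix.det_transpose, Matrix.det_apply']
    refine h2.congr_fun fun k => ?_
    rw [qIntegralTerm, ← Matrix.det_transpose, Matrix.det_apply', ← Finset.prod_pow_eq_pow_sum,
      mul_assoc, Finset.sum_mul]
    congr 1
    refine Finset.sum_congr rfl fun σ _ => ?_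
    rw [Finset.prod_mul_distrib, mul_assoc]
    rfl
  refine ⟨fun S => (hsum S).summable, ?_⟩
  rw [qIntegral]
  simp only [(hsum _).tsum_eq]
  have h3 : ∀ S : Finset (Fin r), (∏ i ∈ S, -α i) * (∏ i ∈ Sᶜ, β i) * (1 - q) ^ r *
      (C * (Matrix.of fun i l => X S i l).det) =
      ∑ σ : Equiv.Perm (Fin r), (1 - q) ^ r * C * (((Equiv.Perm.sign σ : ℤ) : ℂ) *
        ((∏ i ∈ S, -α i * ∑' k : ℕ, h i (σ i) (α i * q ^ k) * q ^ k) *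
          ∏ i ∈ Sᶜ, β i * ∑' k : ℕ, h i (σ i) (β i * q ^ k) * q ^ k)) := by
    intro S
    rw [← Matrix.det_transpose, Matrix.det_apply', Finset.mul_sum, Finset.mul_sum]
    refine Finset.sum_congr rfl fun σ _ => ?_
    simp only [Matrix.transpose_apply, Matrix.of_apply]
    rw [← Finset.prod_mul_prod_compl S, Finset.prod_mul_distrib, Finset.prod_mul_distrib,
      Finset.prod_congr rfl fun i hi => hX1 S i (σ i) hi,
      Finset.prod_congr rfl fun i hi => hX2 S i (σ i) (Finset.mem_compl.mp hi)]
    ring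
  simp only [h3]
  rw [Finset.sum_comm, ← Matrix.det_transpose, Matrix.det_apply', Finset.mul_sum]
  refine Finset.sum_congr rfl fun σ _ => ?_
  rw [← Finset.mul_sum, ← Finset.mul_sum]
  congr 2
  simp only [Matrix.transpose_apply, Matrix.of_apply, jacksonInt]
  -- Writing the `α`-term first makes the subsets in `Finset.prod_add` the sets `S` of the
  -- definition.
  rw [Finset.prod_congr rfl fun i _ => (by ring : β i * (∑' k : ℕ, h i (σ i) (β i * q ^ k) * q ^ k)
    - α i * ∑' k : ℕ, h i (σ i) (α i * q ^ k) * q ^ k =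
      -α i * (∑' k : ℕ, h i (σ i) (α i * q ^ k) * q ^ k) +
        β i * ∑' k : ℕ, h i (σ i) (β i * q ^ k) * q ^ k), Finset.prod_add, Finset.powerset_univ]
  simp only [Finset.compl_eq_univ_sdiff]

/-! ### The Vandermonde form of the pair product. -/

/-- The projective Vandermonde determinant applies because `t_j (t_i² + a) - t_i (t_j² + a) = -a
(t_i - t_j)(1 - t_i t_j / a)`. -/
theorem prod_pair_eq_det {r : ℕ} {a : ℂ} (ha : a ≠ 0) (t : Fin r → ℂ) :
    ∏ i, ∏ j ∈ Finset.Ioi i, (t i - t j) * (1 - t i * t j / a) =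
      ((-a) ^ r.choose 2)⁻¹ *
        (Matrix.of fun i l : Fin r => t i ^ (l : ℕ) * (t i ^ 2 + a) ^ (r - 1 - l : ℕ)).det := by
  have h := Matrix.det_projVandermonde t (fun i => t i ^ 2 + a)
  have h1 : Matrix.projVandermonde t (fun i => t i ^ 2 + a) =
      Matrix.of fun i l : Fin r => t i ^ (l : ℕ) * (t i ^ 2 + a) ^ (r - 1 - l : ℕ) := by
    ext i k
    have : r - 1 - (k : ℕ) = r - (k + 1) := by omega
    simp [Matrix.projVandermonde, Matrix.rectVandermonde, Fin.val_rev, this]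
  have h2 : ∏ i : Fin r, ∏ _j ∈ Finset.Ioi i, (-a) = (-a) ^ r.choose 2 := by
    rw [Finset.prod_congr rfl fun i _ => Finset.prod_const (-a), Finset.prod_pow_eq_pow_sum]
    congr 1
    simp only [Fin.card_Ioi]
    rw [Fin.sum_univ_eq_sum_range (fun i => r - 1 - i), Finset.sum_range_reflect (fun i => i),
      Finset.sum_range_id, Nat.choose_two_right]
  rw [← h1, h, eq_inv_mul_iff_mul_eq₀ (pow_ne_zero _ (neg_ne_zero.mpr ha)), ← h2,
    ← Finset.prod_mul_distrib]
  refine Finset.prod_congr rfl fun i _ => ?_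
  rw [← Finset.prod_mul_distrib]
  refine Finset.prod_congr rfl fun j _ => ?_
  field_simp
  ring

/-- The monomial weights that enter the determinant form of the integrand. -/
def pairWeight (a : ℂ) (r l : ℕ) (t : ℂ) : ℂ := t ^ l * (t ^ 2 + a) ^ (r - 1 - l)

theorem differentiable_pairWeight (a : ℂ) (r l : ℕ) : Differentiable ℂ (pairWeight a r l) := by
  unfold pairWeight
  fun_prop

/-- This is `splitPoly` evaluated at `T = (t² + a)/t` and homogenised by `t ^ (r - 1)`. The degree
is `r - 1` for every `j`, so one set of weights serves all columns. -/
theorem prod_mul_prod_eq_sum_pairWeight (a : ℂ) (α β : ℕ → ℂ) {r j : ℕ} (hj : j < r) {t : ℂ}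
    (ht : t ≠ 0) :
    (∏ l ∈ Finset.range j, (t ^ 2 + a - t * α l)) *
        ∏ m ∈ Finset.range (r - 1 - j), (t ^ 2 + a - t * β m) =
      ∑ k : Fin r, pairWeight a r k t * (splitPoly α β r j).coeff (r - 1 - k) := by
  have h := splitPoly_eval α β hj ((t ^ 2 + a) / t)
  have h1 : ∀ (γ : ℕ → ℂ) (n : ℕ), ∏ l ∈ Finset.range n, (t ^ 2 + a - t * γ l) =
      t ^ n * ∏ l ∈ Finset.range n, ((t ^ 2 + a) / t - γ l) := by
    intro γ n
    rw [show t ^ n = ∏ _l ∈ Finset.range n, t by simp, ← Finset.prod_mul_distrib]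
    refine Finset.prod_congr rfl fun l _ => ?_
    field_simp
  have h2 : (splitPoly α β r j).eval ((t ^ 2 + a) / t) =
      (∏ l ∈ Finset.range j, ((t ^ 2 + a) / t - α l)) *
        ∏ m ∈ Finset.range (r - 1 - j), ((t ^ 2 + a) / t - β m) := by
    simp [splitPoly, Polynomial.eval_prod]
  calc _ = t ^ (r - 1) * (splitPoly α β r j).eval ((t ^ 2 + a) / t) := by
        rw [h1, h1, h2, ← Nat.add_sub_cancel' (show j ≤ r - 1 by omega), pow_add]
        simp only [Nat.add_sub_cancel_left]
        ring
    _ = _ := by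
        rw [h, Finset.mul_sum]
        refine Finset.sum_congr rfl fun k _ => ?_
        have hk := k.2
        rw [pairWeight, div_pow]
        have : t ^ (r - 1) = t ^ (k : ℕ) * t ^ (r - 1 - k) := by
          rw [← pow_add]; congr 1; omega
        rw [this]
        field_simp

/-! ### Parameter shifts as changes of weight. -/

section
variable {q : ℂ} (hq : ‖q‖ < 1)
include hq

/-- Shifting `u` to `uq` multiplies the weight at the node `t` by `(1 - t/u)(1 - tu/a)`, which is
linear in `t + a/t` after division by `t`. -/
theorem nodeFactor_mul_q (hq0 : q ≠ 0) {a : ℂ} (ha : a ≠ 0) (k : ℕ) (p : ℂ) {u : ℂ}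
    (hu : u ≠ 0) :
    (1 - p * u / a) * nodeFactor q a k p (u * q) =
      nodeFactor q a k p u * (((p * q ^ k) ^ 2 + a - p * q ^ k * (u + a / u)) / a) := by
  have h1 : qFac q (p * q ^ (k + 1) / (u * q)) =
      (1 - p * q ^ k / u) * qFac q (p * q ^ (k + 1) / u) := by
    rw [show p * q ^ (k + 1) / (u * q) = p * q ^ k / u by rw [pow_succ]; field_simp,
      qFac_eq_one_sub_mul hq (p * q ^ k / u)]
    ring_nf
  have h2 : (1 - p * u / a) * qPoch q (p * (u * q) / a) k =
      qPoch q (p * u / a) k * (1 - p * q ^ k * u / a) := by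
    have := qPoch_succ' q (p * u / a) k
    rw [qPoch_succ] at this
    rw [show p * (u * q) / a = p * u / a * q by ring, ← this]
    ring
  have h3 : (1 - p * q ^ k / u) * (1 - p * q ^ k * u / a) =
      ((p * q ^ k) ^ 2 + a - p * q ^ k * (u + a / u)) / a := by
    field_simp
    ring
  rw [nodeFactor, nodeFactor, h1, ← h3]
  linear_combination ((1 - p * q ^ k / u) * qFac q (p * q ^ (k + 1) / u)) * h2

theorem nodeFactor_mul_q_pow (hq0 : q ≠ 0) {a : ℂ} (ha : a ≠ 0) (k : ℕ) (p : ℂ) {u : ℂ}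
    (hu : u ≠ 0) (j : ℕ) :
    qPoch q (p * u / a) j * nodeFactor q a k p (u * q ^ j) =
      nodeFactor q a k p u * ((∏ l ∈ Finset.range j,
        ((p * q ^ k) ^ 2 + a - p * q ^ k * (u * q ^ l + a / (u * q ^ l)))) / a ^ j) := by
  induction j with
  | zero => simp
  | succ j ih =>
    have h := nodeFactor_mul_q hq hq0 ha k p (mul_ne_zero hu (pow_ne_zero j hq0))
    rw [qPoch_succ, Finset.prod_range_succ, pow_succ, ← mul_assoc u,
      show p * u / a * q ^ j = p * (u * q ^ j) / a by ring, mul_assoc, h, ← mul_assoc, ih,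
      pow_succ]
    ring

theorem jacksonSeries_shift (hq0 : q ≠ 0) {a : ℂ} (ha : a ≠ 0) {p b c d e g : ℂ} (hp : p ≠ 0)
    (hc : c ≠ 0) (hd : d ≠ 0) {r j : ℕ} (hj : j < r) :
    a ^ (r - 1) * (qPoch q (p * c / a) j * qPoch q (p * d / a) (r - 1 - j)) *
        jacksonSeries q a (fun _ => 1) p b (c * q ^ j) (d * q ^ (r - 1 - j)) e g =
      ∑ k : Fin r, jacksonSeries q a (pairWeight a r k) p b c d e g *
        (splitPoly (fun l => c * q ^ l + a / (c * q ^ l))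
          (fun l => d * q ^ l + a / (d * q ^ l)) r j).coeff (r - 1 - k) := by
  simp only [jacksonSeries]
  rw [← tsum_mul_left]
  simp only [← tsum_mul_right]
  rw [← Summable.tsum_finsetSum (f := fun (k : Fin r) (n : ℕ) => pairWeight a r k (p * q ^ n) *
      jacksonTerm q a p b c d e g n * (splitPoly (fun l => c * q ^ l + a / (c * q ^ l))
          (fun l => d * q ^ l + a / (d * q ^ l)) r j).coeff (r - 1 - k)) fun k _ =>
    (summable_jackson hq (differentiable_pairWeight a r k).continuous a p b c d e g).mul_right _]
  refine tsum_congr fun n => ?_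
  have ht : p * q ^ n ≠ 0 := mul_ne_zero hp (pow_ne_zero n hq0)
  have h := prod_mul_prod_eq_sum_pairWeight a (fun l => c * q ^ l + a / (c * q ^ l))
    (fun l => d * q ^ l + a / (d * q ^ l)) hj ht
  rw [Finset.sum_congr rfl fun k _ => mul_right_comm _ _ _, ← Finset.sum_mul, ← h]
  have h1 := nodeFactor_mul_q_pow hq hq0 ha n p hc j
  have h2 := nodeFactor_mul_q_pow hq hq0 ha n p hd (r - 1 - j)
  have hpow : a ^ (r - 1) = a ^ j * a ^ (r - 1 - j) := by
    rw [← pow_add]; congr 1; omega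
  simp only [jacksonTerm]
  rw [hpow]
  rw [← mul_div_assoc, eq_div_iff (pow_ne_zero _ ha)] at h1 h2
  simp only [one_mul]
  generalize nodeFactor q a n p (c * q ^ j) = X at *
  generalize nodeFactor q a n p (d * q ^ (r - 1 - j)) = Y at *
  generalize q ^ n * (1 - (p * q ^ n) ^ 2 / a) = Z at *
  calc _ = Z * (nodeFactor q a n p p * nodeFactor q a n p b * nodeFactor q a n p e *
        nodeFactor q a n p g) * ((qPoch q (p * c / a) j * X * a ^ j) *
          (qPoch q (p * d / a) (r - 1 - j) * Y * a ^ (r - 1 - j))) := by ring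
    _ = _ := by rw [h1, h2]; ring

/-- The series based at `p` and at `b` acquire different finite factors under the shift. In
`jacksonForm` each series is multiplied by infinite products at the other endpoint. Splitting these
supplies the complementary finite factors, so both halves carry the same prefactor. -/
theorem jacksonForm_shift (hq0 : q ≠ 0) {a : ℂ} (ha : a ≠ 0) {p b c d e g : ℂ} (hp : p ≠ 0)
    (hb : b ≠ 0) (hc : c ≠ 0) (hd : d ≠ 0) {r j : ℕ} (hj : j < r) :
    a ^ (r - 1) * (qPoch q (p * c / a) j * qPoch q (b * c / a) j *
        (qPoch q (p * d / a) (r - 1 - j) * qPoch q (b * d / a) (r - 1 - j))) *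
        jacksonForm q a (fun _ => 1) p b (c * q ^ j) (d * q ^ (r - 1 - j)) e g =
      ∑ k : Fin r, jacksonForm q a (pairWeight a r k) p b c d e g *
        (splitPoly (fun l => c * q ^ l + a / (c * q ^ l))
          (fun l => d * q ^ l + a / (d * q ^ l)) r j).coeff (r - 1 - k) := by
  have h1 := jacksonSeries_shift hq hq0 ha (p := p) (b := b) (e := e) (g := g) hp hc hd hj
  have h2 := jacksonSeries_shift hq hq0 ha (p := b) (b := p) (e := e) (g := g) hb hc hd hj
  have hF : ∀ w u : ℂ, ∀ i : ℕ, qFac q (w * u / a) =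
      qPoch q (w * u / a) i * qFac q (w * (u * q ^ i) / a) := by
    intro w u i
    rw [qFac_eq_qPoch_mul hq (w * u / a) i]
    ring_nf
  simp only [jacksonForm, sub_mul, Finset.sum_sub_distrib]
  rw [hF p c j, hF b c j, hF p d (r - 1 - j), hF b d (r - 1 - j)]
  have e1 : ∀ (s : Fin r → ℂ) (w : Fin r → ℂ) (A B : ℂ),
      ∑ k, A * s k * B * w k = A * B * ∑ k, s k * w k := fun s w A B => by
    rw [Finset.mul_sum]
    exact Finset.sum_congr rfl fun k _ => by ring
  rw [e1, e1, ← h1, ← h2]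
  ring

end

/-! ### Evaluation of the columns and comparison of the two bases. -/

section
variable {q : ℂ} (hq : ‖q‖ < 1)
include hq

/-- The counterpart of `nodeFactor_mul_q_pow` on the product side. The dependence on `j` in the row
variable is again a product of linear factors in `x + κ/x`. -/
theorem qPoch_mul_qFac_div (hq0 : q ≠ 0) {κ x c : ℂ} (hκ : κ ≠ 0) (hc : c ≠ 0) (j : ℕ) :
    qPoch q (c * x) j * qFac q (x * q / (κ * (c * q ^ j))) =
      qFac q (x * q / (κ * c)) * ((∏ l ∈ Finset.range j,
        (x ^ 2 + κ - x * (κ * (c * q ^ l) + 1 / (c * q ^ l)))) / κ ^ j) := by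
  induction j with
  | zero => simp
  | succ j ih =>
    have hC : c * q ^ j ≠ 0 := mul_ne_zero hc (pow_ne_zero j hq0)
    have h1 : qFac q (x * q / (κ * (c * q ^ (j + 1)))) =
        (1 - x / (κ * (c * q ^ j))) * qFac q (x * q / (κ * (c * q ^ j))) := by
      rw [show x * q / (κ * (c * q ^ (j + 1))) = x / (κ * (c * q ^ j)) by
        rw [pow_succ]; field_simp, qFac_eq_one_sub_mul hq (x / (κ * (c * q ^ j)))]
      ring_nf
    have h2 : (1 - c * x * q ^ j) * (1 - x / (κ * (c * q ^ j))) =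
        (x ^ 2 + κ - x * (κ * (c * q ^ j) + 1 / (c * q ^ j))) / κ := by
      rw [show c * x * q ^ j = c * q ^ j * x by ring]
      generalize c * q ^ j = C at *
      field_simp
      ring
    rw [h1, qPoch_succ, Finset.prod_range_succ, pow_succ]
    calc _ = (qPoch q (c * x) j * qFac q (x * q / (κ * (c * q ^ j)))) *
          ((1 - c * x * q ^ j) * (1 - x / (κ * (c * q ^ j)))) := by ring
      _ = _ := by rw [ih, h2]; ring_nf

theorem jacksonForm_sum_coeff (hq0 : q ≠ 0) {a b c d e f x : ℂ} (ha : a ≠ 0) (hb : b ≠ 0)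
    (hc : c ≠ 0) (hd : d ≠ 0) (he : e ≠ 0) (hf : f ≠ 0) (hx : x ≠ 0) {r j : ℕ} (hj : j < r)
    (hbal : a ^ 2 * q ^ 2 = b * c * d * e * f * q ^ r) :
    ∑ k : Fin r, jacksonForm q a (pairWeight a r k) (a * x) b c d e (f / x) *
        (splitPoly (fun l => c * q ^ l + a / (c * q ^ l))
          (fun l => d * q ^ l + a / (d * q ^ l)) r j).coeff (r - 1 - k) =
      (a ^ (r - 1) / (f / a) ^ (r - 1) * qFac q (a * q / (c * d) / q ^ (r - 1)) *
        (endFactor q a (a * x) b * (qFac q (a * x * q / (c * f)) * qFac q (a * x * q / (d * f)) *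
          qFac q (a * x * q / (e * f))))) *
      (qPoch q (b * c / a) j * qPoch q (b * d / a) (r - 1 - j) *
        (qFac q (a * q / (c * e) / q ^ j) * qFac q (a * q / (d * e) / q ^ (r - 1 - j)))) *
      ∑ k : Fin r, pairWeight (f / a) r k x *
        (splitPoly (fun l => f / a * (c * q ^ l) + 1 / (c * q ^ l))
          (fun l => f / a * (d * q ^ l) + 1 / (d * q ^ l)) r j).coeff (r - 1 - k) := by
  have hκ : f / a ≠ 0 := div_ne_zero hf ha
  have hpow : q ^ r = q ^ j * q ^ (r - 1 - j) * q := by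
    rw [← pow_add, ← pow_succ]; congr 1; omega
  rw [← jacksonForm_shift hq hq0 ha (mul_ne_zero ha hx) hb hc hd hj,
    ← prod_mul_prod_eq_sum_pairWeight _ _ _ hj hx,
    jacksonForm_eq hq hq0 ha (mul_ne_zero ha hx) hb (mul_ne_zero hc (pow_ne_zero _ hq0))
      (mul_ne_zero hd (pow_ne_zero _ hq0)) he (div_ne_zero hf hx) (by
        -- The shifts `q^j` and `q^(r-1-j)` multiply to `q^(r-1)`, so the balancing condition of the
        -- `₈φ₇` sum is the hypothesis with one factor `q` cancelled.
        have h1 : q * (a ^ 2 * q - b * c * d * e * f * (q ^ j * q ^ (r - 1 - j))) = 0 := by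
          rw [hpow] at hbal
          linear_combination hbal
        have h2 := (mul_eq_zero.mp h1).resolve_left hq0
        field_simp
        linear_combination -h2)]
  have h1 := qPoch_mul_qFac_div hq hq0 (x := x) hκ hc j
  have h2 := qPoch_mul_qFac_div hq hq0 (x := x) hκ hd (r - 1 - j)
  have e1 : a * q / (c * q ^ j * (f / x)) = x * q / (f / a * (c * q ^ j)) := by field_simp
  have e2 : a * q / (d * q ^ (r - 1 - j) * (f / x)) =
      x * q / (f / a * (d * q ^ (r - 1 - j))) := by field_simp
  have e3 : a * q / (e * (f / x)) = a * x * q / (e * f) := by field_simp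
  have e4 : a * q / (c * q ^ j * (d * q ^ (r - 1 - j))) = a * q / (c * d) / q ^ (r - 1) := by
    rw [show q ^ (r - 1) = q ^ j * q ^ (r - 1 - j) by rw [← pow_add]; congr 1; omega]
    field_simp
  have e5 : a * q / (c * q ^ j * e) = a * q / (c * e) / q ^ j := by field_simp
  have e6 : a * q / (d * q ^ (r - 1 - j) * e) = a * q / (d * e) / q ^ (r - 1 - j) := by
    field_simp
  have e7 : a * x * c / a = c * x := by field_simp
  have e8 : a * x * d / a = d * x := by field_simp
  have e9 : a * x * q / (c * f) = x * q / (f / a * c) := by field_simp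
  have e10 : a * x * q / (d * f) = x * q / (f / a * d) := by field_simp
  have hκp : (f / a) ^ (r - 1) = (f / a) ^ j * (f / a) ^ (r - 1 - j) := by
    rw [← pow_add]; congr 1; omega
  rw [pairFactor, e1, e2, e3, e4, e5, e6, e7, e8, e9, e10, hκp]
  generalize qFac q (x * q / (f / a * (c * q ^ j))) = X1 at *
  generalize qFac q (x * q / (f / a * (d * q ^ (r - 1 - j)))) = X2 at *
  generalize qPoch q (b * c / a) j = X3
  generalize qPoch q (b * d / a) (r - 1 - j) = X4
  generalize endFactor q a (a * x) b = X5
  generalize qFac q (a * q / (c * d) / q ^ (r - 1)) = X6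
  generalize qFac q (a * x * q / (e * f)) = X7
  generalize qFac q (a * q / (c * e) / q ^ j) = X8
  generalize qFac q (a * q / (d * e) / q ^ (r - 1 - j)) = X9
  calc _ = a ^ (r - 1) * X3 * X4 * X5 * X6 * X7 * X8 * X9 * (qPoch q (c * x) j * X1) *
        (qPoch q (d * x) (r - 1 - j) * X2) := by ring
    _ = _ := by rw [h1, h2]; ring

/-- The factor in `c d` has the same shift `r - 1` in every column. Its `r`-th power is traded for
the staggered product of the final formula, at the cost of finite factors that `splitConst_ratio`
absorbs. -/
theorem qFac_div_pow_self (hq0 : q ≠ 0) (Y : ℂ) (n : ℕ) :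
    qFac q (Y / q ^ (n - 1)) ^ n =
      (∏ i ∈ Finset.range n, qFac q (Y / q ^ i)) *
        ∏ k ∈ Finset.range n, (1 - Y / q ^ k) ^ k := by
  induction n with
  | zero => simp
  | succ n ih =>
    rw [Finset.prod_range_succ, Finset.prod_range_succ]
    rcases n with _ | n
    · simp
    · have h : qFac q (Y / q ^ (n + 1)) = (1 - Y / q ^ (n + 1)) * qFac q (Y / q ^ n) := by
        rw [qFac_eq_one_sub_mul hq, show Y / q ^ (n + 1) * q = Y / q ^ n by
          rw [pow_succ]; field_simp]
      simp only [Nat.add_sub_cancel] at ih ⊢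
      rw [pow_succ, mul_comm, mul_mul_mul_comm, ← ih, mul_comm (_ ^ (n + 1)), mul_assoc,
        ← mul_pow, ← h]

end

theorem prod_one_sub_pow_reflect (q z : ℂ) (n : ℕ) :
    ∏ k ∈ Finset.range n, (1 - z * q ^ (n - 1 - k)) ^ k = ∏ j ∈ Finset.range n, qPoch q z j := by
  induction n with
  | zero => simp
  | succ n ih =>
    rw [Finset.prod_range_succ' _ n, Finset.prod_range_succ, ← ih, qPoch,
      ← Finset.prod_range_reflect (fun l => 1 - z * q ^ l), ← Finset.prod_mul_distrib]
    simp only [pow_zero, mul_one]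
    refine Finset.prod_congr rfl fun k _ => ?_
    rw [show n + 1 - 1 - (k + 1) = n - 1 - k by omega, pow_succ]

/-- Every difference of roots factors. With `C = c q^j` and `D = d q^(k-1-j)`, it is `(D - C)(1 -
a/(CD))` in one basis and `(D - C)(κ - 1/(CD))` in the other. The product `CD` depends only on `k`,
which explains the `k`-th powers, and the relation for `z` gives `1/(CD) = κ z q^(r-1-k)`. -/
theorem splitConst_ratio {q a κ c d z : ℂ} (hq0 : q ≠ 0) (hc : c ≠ 0)
    (hd : d ≠ 0) {r : ℕ} (hz : κ * c * d * z * q ^ r = q ^ 2) :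
    splitConst (fun l => κ * (c * q ^ l) + 1 / (c * q ^ l))
        (fun l => κ * (d * q ^ l) + 1 / (d * q ^ l)) r *
        ∏ k ∈ Finset.range r, (1 - a * q / (c * d) / q ^ k) ^ k =
      splitConst (fun l => c * q ^ l + a / (c * q ^ l))
        (fun l => d * q ^ l + a / (d * q ^ l)) r * κ ^ r.choose 2 *
        ∏ k ∈ Finset.range r, (1 - z * q ^ (r - 1 - k)) ^ k := by
  have hκ : κ ^ r.choose 2 = ∏ k ∈ Finset.range r, κ ^ k := by
    rw [Finset.prod_pow_eq_pow_sum, Finset.sum_range_id, Nat.choose_two_right]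
  rw [hκ, splitConst, splitConst, ← Finset.prod_mul_distrib, ← Finset.prod_mul_distrib,
    ← Finset.prod_mul_distrib]
  refine Finset.prod_congr rfl fun k hk => ?_
  have hkr := Finset.mem_range.mp hk
  have hconst : ∀ y : ℂ, y ^ k = ∏ _j ∈ Finset.range k, y := fun y => by simp
  rw [hconst (1 - a * q / (c * d) / q ^ k), hconst κ, hconst (1 - z * q ^ (r - 1 - k)), ← Finset.prod_mul_distrib, ← Finset.prod_mul_distrib,
    ← Finset.prod_mul_distrib]
  refine Finset.prod_congr rfl fun j hj => ?_
  have hjk := Finset.mem_range.mp hj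
  have hp1 : q ^ k = q ^ (k - 1 - j) * q ^ j * q := by
    rw [← pow_add, ← pow_succ]; congr 1; omega
  have hp2 : q ^ r = q ^ (r - 1 - k) * q ^ k * q := by
    rw [← pow_add, ← pow_succ]; congr 1; omega
  have hj0 : q ^ j ≠ 0 := pow_ne_zero _ hq0
  have hj1 : q ^ (k - 1 - j) ≠ 0 := pow_ne_zero _ hq0
  rw [hp2, hp1] at hz
  rw [hp1]
  generalize q ^ j = s at *
  generalize q ^ (k - 1 - j) = t at *
  generalize q ^ (r - 1 - k) = w at *
  have hz' : κ * c * d * z * w * t * s = 1 := by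
    have : q ^ 2 * (κ * c * d * z * w * t * s - 1) = 0 := by linear_combination hz
    exact sub_eq_zero.mp ((mul_eq_zero.mp this).resolve_left (pow_ne_zero 2 hq0))
  have h1 : (κ * (d * t) + 1 / (d * t) - (κ * (c * s) + 1 / (c * s))) =
      (d * t - c * s) * (κ * (1 - z * w)) := by
    have : κ * z * w = 1 / (c * s * (d * t)) := by
      rw [eq_div_iff (by positivity)]; linear_combination hz'
    rw [mul_sub, mul_one, ← mul_assoc κ z w, this]
    field_simp
    ring
  rw [h1]
  field_simp
  ring

theorem choose_two_mul_two (r : ℕ) : r.choose 2 * 2 = r * (r - 1) := by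
  rw [Nat.choose_two_right, ← Finset.sum_range_id, Finset.sum_range_id_mul_two]

/-! ### The determinant of one-dimensional integrals. -/

section
variable {q : ℂ} (hq : ‖q‖ < 1)
include hq

theorem det_jacksonForm_of_ne_zero (hq0 : q ≠ 0) {a b c d e f : ℂ} {r : ℕ} {x : Fin r → ℂ}
    (ha : a ≠ 0) (hb : b ≠ 0) (hc : c ≠ 0) (hd : d ≠ 0) (he : e ≠ 0) (hf : f ≠ 0)
    (hx : ∀ i, x i ≠ 0) (hbal : a ^ 2 * q ^ 2 = b * c * d * e * f * q ^ r)
    (hK : splitConst (fun l => c * q ^ l + a / (c * q ^ l))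
      (fun l => d * q ^ l + a / (d * q ^ l)) r ≠ 0) :
    (Matrix.of fun i k : Fin r =>
        jacksonForm q a (pairWeight a r k) (a * x i) b c d e (f / x i)).det =
      (-1) ^ r.choose 2 * (a ^ r.choose 2) ^ 2 *
        (∏ i, ∏ j ∈ Finset.Ioi i, (x i - x j) * (1 - a * x i * x j / f)) *
        (∏ i, endFactor q a (a * x i) b * (qFac q (a * x i * q / (c * f)) *
          qFac q (a * x i * q / (d * f)) * qFac q (a * x i * q / (e * f)))) *
        ∏ j ∈ Finset.range r, (qPoch q (b * c / a) j * qPoch q (b * d / a) j *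
          qPoch q (b * e / a) j) * (qFac q (a * q / (c * d) / q ^ j) *
          qFac q (a * q / (c * e) / q ^ j) * qFac q (a * q / (d * e) / q ^ j)) := by
  have hκ : f / a ≠ 0 := div_ne_zero hf ha
  set α : ℕ → ℂ := fun l => c * q ^ l + a / (c * q ^ l) with hα
  set β : ℕ → ℂ := fun l => d * q ^ l + a / (d * q ^ l) with hβ
  set α' : ℕ → ℂ := fun l => f / a * (c * q ^ l) + 1 / (c * q ^ l) with hα'
  set β' : ℕ → ℂ := fun l => f / a * (d * q ^ l) + 1 / (d * q ^ l) with hβ'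
  set M : Matrix (Fin r) (Fin r) ℂ := Matrix.of fun i k : Fin r =>
    jacksonForm q a (pairWeight a r k) (a * x i) b c d e (f / x i) with hM
  set E : Fin r → ℂ := fun i =>
    a ^ (r - 1) / (f / a) ^ (r - 1) * qFac q (a * q / (c * d) / q ^ (r - 1)) *
      (endFactor q a (a * x i) b * (qFac q (a * x i * q / (c * f)) *
        qFac q (a * x i * q / (d * f)) * qFac q (a * x i * q / (e * f)))) with hE
  set F : Fin r → ℂ := fun j =>
    qPoch q (b * c / a) j * qPoch q (b * d / a) (r - 1 - j) *
      (qFac q (a * q / (c * e) / q ^ (j : ℕ)) *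
        qFac q (a * q / (d * e) / q ^ (r - 1 - j : ℕ))) with hF
  set N : Matrix (Fin r) (Fin r) ℂ := Matrix.of fun i k : Fin r =>
    x i ^ (k : ℕ) * (x i ^ 2 + f / a) ^ (r - 1 - k : ℕ) with hN
  -- Right multiplication by each coefficient matrix changes the monomial weights into a split
  -- basis. The entrywise evaluation then relates the two matrices by a row scaling `E` and a column
  -- scaling `F`.
  have hmat : M * (Matrix.of fun k j : Fin r => (splitPoly α β r j).coeff (r - 1 - k)) =
      Matrix.of fun i j => E i * (Matrix.of fun i j => F j * (N *
        (Matrix.of fun k j : Fin r => (splitPoly α' β' r j).coeff (r - 1 - k))) i j) i j := by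
    ext i j
    have h := jacksonForm_sum_coeff hq hq0 ha hb hc hd he hf (hx i) j.2 hbal
    simp only [Matrix.of_apply]
    rw [Matrix.mul_apply, Matrix.mul_apply, ← mul_assoc]
    exact h
  have hdet := congrArg Matrix.det hmat
  rw [Matrix.det_mul, det_coeff_splitPoly, Matrix.det_mul_column, Matrix.det_mul_row,
    Matrix.det_mul, det_coeff_splitPoly] at hdet
  have hNdet := prod_pair_eq_det hκ x
  rw [eq_inv_mul_iff_mul_eq₀ (pow_ne_zero _ (neg_ne_zero.mpr hκ))] at hNdet
  have hV : ∏ i, ∏ j ∈ Finset.Ioi i, (x i - x j) * (1 - x i * x j / (f / a)) =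
      ∏ i, ∏ j ∈ Finset.Ioi i, (x i - x j) * (1 - a * x i * x j / f) := by
    refine Finset.prod_congr rfl fun i _ => Finset.prod_congr rfl fun j _ => ?_
    field_simp
  have hEprod : ∏ i, E i = (a ^ r.choose 2) ^ 2 / ((f / a) ^ r.choose 2) ^ 2 *
      qFac q (a * q / (c * d) / q ^ (r - 1)) ^ r *
      ∏ i, endFactor q a (a * x i) b * (qFac q (a * x i * q / (c * f)) *
        qFac q (a * x i * q / (d * f)) * qFac q (a * x i * q / (e * f))) := by
    rw [hE, Finset.prod_mul_distrib, Finset.prod_const, Finset.card_univ, Fintype.card_fin,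
      mul_pow, div_pow, ← pow_mul, ← pow_mul, ← pow_mul, ← pow_mul, choose_two_mul_two,
      mul_comm r]
  have hFprod : ∏ j, F j = ∏ j ∈ Finset.range r, (qPoch q (b * c / a) j * qPoch q (b * d / a) j) *
      (qFac q (a * q / (c * e) / q ^ j) * qFac q (a * q / (d * e) / q ^ j)) := by
    have h := Fin.prod_univ_eq_prod_range (fun j => qPoch q (b * c / a) j *
      qPoch q (b * d / a) (r - 1 - j) * (qFac q (a * q / (c * e) / q ^ j) *
        qFac q (a * q / (d * e) / q ^ (r - 1 - j))) ) r
    rw [hF, h]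
    simp only [Finset.prod_mul_distrib]
    rw [Finset.prod_range_reflect (fun j => qPoch q (b * d / a) j),
      Finset.prod_range_reflect (fun j => qFac q (a * q / (d * e) / q ^ j))]
  -- With `κ = f/a`, balancing forces `z = be/a`. The ratio of the two basis determinants thus
  -- produces the factors in `b e / a` that the columns lack.
  have hz : f / a * c * d * (b * e / a) * q ^ r = q ^ 2 := by
    field_simp
    linear_combination -hbal
  have hratio := splitConst_ratio (a := a) hq0 hc hd hz
  rw [prod_one_sub_pow_reflect] at hratio
  have hY := qFac_div_pow_self hq hq0 (a * q / (c * d)) r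
  refine mul_right_cancel₀ hK ?_
  rw [hdet, hEprod, hFprod, ← hNdet, hV, hY, neg_pow (f / a)]
  have hκC : (f / a) ^ r.choose 2 ≠ 0 := pow_ne_zero _ hκ
  simp only [Finset.prod_mul_distrib] at hratio ⊢
  generalize (f / a) ^ r.choose 2 = k at *
  generalize splitConst α β r = K at *
  generalize splitConst α' β' r = K' at *
  generalize (∏ k ∈ Finset.range r, (1 - a * q / (c * d) / q ^ k) ^ k) = Z at *
  generalize (∏ j ∈ Finset.range r, qPoch q (b * e / a) j) = Z' at *
  have hr : K' * Z * k / k ^ 2 = K * Z' := by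
    rw [div_eq_iff (pow_ne_zero 2 hκC)]; linear_combination k * hratio
  generalize (∏ x ∈ Finset.range r, qPoch q (b * c / a) x) = X1
  generalize (∏ x ∈ Finset.range r, qPoch q (b * d / a) x) = X2
  generalize (∏ x ∈ Finset.range r, qFac q (a * q / (c * d) / q ^ x)) = X3
  generalize (∏ x ∈ Finset.range r, qFac q (a * q / (c * e) / q ^ x)) = X4
  generalize (∏ x ∈ Finset.range r, qFac q (a * q / (d * e) / q ^ x)) = X5
  generalize (∏ i, ∏ j ∈ Finset.Ioi i, (x i - x j)) = X6
  generalize (∏ i, ∏ j ∈ Finset.Ioi i, (1 - a * x i * x j / f)) = X7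
  generalize (∏ i, endFactor q a (a * x i) b) = X8
  generalize (∏ i, qFac q (a * x i * q / (c * f))) = X9
  generalize (∏ i, qFac q (a * x i * q / (d * f))) = Y1
  generalize (∏ i, qFac q (a * x i * q / (e * f))) = Y2
  linear_combination ((-1) ^ r.choose 2 * (a ^ r.choose 2) ^ 2 * X1 * X2 * X3 * X4 * X5 * X6 *
    X7 * X8 * X9 * Y1 * Y2) * hr

omit hq in
-- As a function of `s`, each difference of roots vanishes only at the two points where `D = Cs` or
-- `CDs = a`, apart from the excluded `s = 0`. There are finitely many differences, so a punctured
-- neighbourhood of `1` avoids all these zeros.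
theorem splitConst_ne_zero_of_perturbation (hq0 : q ≠ 0) {a c d : ℂ} (hc : c ≠ 0) (hd : d ≠ 0)
    (r : ℕ) : ∀ᶠ s in 𝓝[≠] (1 : ℂ), splitConst (fun l => c * s * q ^ l + a / (c * s * q ^ l))
      (fun l => d * q ^ l + a / (d * q ^ l)) r ≠ 0 := by
  have hne : ∀ w : ℂ, ∀ᶠ s in 𝓝[≠] (1 : ℂ), s ≠ w := by
    intro w
    by_cases hw : w = 1
    · subst hw
      exact eventually_mem_nhdsWithin
    · exact eventually_nhdsWithin_of_eventually_nhds (eventually_ne_nhds (Ne.symm hw))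
  simp only [splitConst, Finset.prod_ne_zero_iff, Finset.mem_range]
  have hfin : ∀ k j : ℕ, ∀ᶠ s in 𝓝[≠] (1 : ℂ), d * q ^ (k - 1 - j) +
      a / (d * q ^ (k - 1 - j)) - (c * s * q ^ j + a / (c * s * q ^ j)) ≠ 0 := by
    intro k j
    have hC : c * q ^ j ≠ 0 := mul_ne_zero hc (pow_ne_zero _ hq0)
    have hD : d * q ^ (k - 1 - j) ≠ 0 := mul_ne_zero hd (pow_ne_zero _ hq0)
    filter_upwards [hne 0, hne (d * q ^ (k - 1 - j) / (c * q ^ j)),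
      hne (a / (c * q ^ j * (d * q ^ (k - 1 - j))))] with s h0 h1 h2
    rw [mul_right_comm c s]
    generalize c * q ^ j = C at *
    generalize d * q ^ (k - 1 - j) = D at *
    have e : D + a / D - (C * s + a / (C * s)) = (D - C * s) * (C * D * s - a) / (C * D * s) := by
      field_simp
      ring
    rw [e]
    refine div_ne_zero (mul_ne_zero (fun h => h1 ?_) fun h => h2 ?_) (by positivity)
    · rw [eq_div_iff hC]; linear_combination -h
    · rw [eq_div_iff (by positivity)]; linear_combination h
  have h1 : ∀ k : ℕ, ∀ᶠ s in 𝓝[≠] (1 : ℂ), ∀ j, j < k → d * q ^ (k - 1 - j) +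
      a / (d * q ^ (k - 1 - j)) - (c * s * q ^ j + a / (c * s * q ^ j)) ≠ 0 := fun k =>
    (Set.finite_lt_nat k).eventually_all.mpr fun j _ => hfin k j
  exact (Set.finite_lt_nat r).eventually_all.mpr fun k _ => h1 k

/-- The determinant of one-dimensional Jackson integrals, with denominators cleared. -/
theorem det_jacksonForm (hq0 : q ≠ 0) {a b c d e f : ℂ} {r : ℕ} {x : Fin r → ℂ}
    (ha : a ≠ 0) (hb : b ≠ 0) (hc : c ≠ 0) (hd : d ≠ 0) (he : e ≠ 0) (hf : f ≠ 0)
    (hx : ∀ i, x i ≠ 0) (hbal : a ^ 2 * q ^ 2 = b * c * d * e * f * q ^ r) :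
    (Matrix.of fun i k : Fin r =>
        jacksonForm q a (pairWeight a r k) (a * x i) b c d e (f / x i)).det =
      (-1) ^ r.choose 2 * (a ^ r.choose 2) ^ 2 *
        (∏ i, ∏ j ∈ Finset.Ioi i, (x i - x j) * (1 - a * x i * x j / f)) *
        (∏ i, endFactor q a (a * x i) b * (qFac q (a * x i * q / (c * f)) *
          qFac q (a * x i * q / (d * f)) * qFac q (a * x i * q / (e * f)))) *
        ∏ j ∈ Finset.range r, (qPoch q (b * c / a) j * qPoch q (b * d / a) j *
          qPoch q (b * e / a) j) * (qFac q (a * q / (c * d) / q ^ j) *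
          qFac q (a * q / (c * e) / q ^ j) * qFac q (a * q / (d * e) / q ^ j)) := by
  have hU : IsOpen ({0}ᶜ : Set ℂ) := isOpen_compl_singleton
  have h1U : ({0}ᶜ : Set ℂ) ∈ 𝓝 (1 : ℂ) := hU.mem_nhds (by simp)
  have hcs : ∀ s ∈ ({0}ᶜ : Set ℂ), c * s ≠ 0 := fun s hs => mul_ne_zero hc hs
  have hes : ∀ s ∈ ({0}ᶜ : Set ℂ), e / s ≠ 0 := fun s hs => div_ne_zero he hs
  have hcd : DifferentiableOn ℂ (fun s : ℂ => c * s) {0}ᶜ := by fun_prop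
  have hed : DifferentiableOn ℂ (fun s : ℂ => e / s) {0}ᶜ :=
    (differentiableOn_const _).div differentiableOn_id fun z hz => hz
  -- The deformation `c → cs`, `e → e/s` preserves the balancing. Both sides are continuous at `s =
  -- 1` and agree at nearby `s ≠ 1`, where the split basis is nondegenerate.
  set L : ℂ → ℂ := fun s => (Matrix.of fun i k : Fin r =>
    jacksonForm q a (pairWeight a r k) (a * x i) b (c * s) d (e / s) (f / x i)).det with hL
  set R : ℂ → ℂ := fun s => (-1) ^ r.choose 2 * (a ^ r.choose 2) ^ 2 *
        (∏ i, ∏ j ∈ Finset.Ioi i, (x i - x j) * (1 - a * x i * x j / f)) *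
        (∏ i, endFactor q a (a * x i) b * (qFac q (a * x i * q / (c * s * f)) *
          qFac q (a * x i * q / (d * f)) * qFac q (a * x i * q / (e / s * f)))) *
        ∏ j ∈ Finset.range r, (qPoch q (b * (c * s) / a) j * qPoch q (b * d / a) j *
          qPoch q (b * (e / s) / a) j) * (qFac q (a * q / (c * s * d) / q ^ j) *
          qFac q (a * q / (c * s * (e / s)) / q ^ j) * qFac q (a * q / (d * (e / s)) / q ^ j))
    with hR
  have hLc : ContinuousAt L 1 := by
    have hentry : ∀ i k : Fin r, ContinuousAt (fun s => jacksonForm q a (pairWeight a r k)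
        (a * x i) b (c * s) d (e / s) (f / x i)) 1 := fun i k =>
      (differentiableOn_jacksonForm hq (differentiable_pairWeight a r k) a hU
        (differentiableOn_const _) (differentiableOn_const _) hcd (differentiableOn_const _) hed
        (differentiableOn_const _) (fun _ _ => mul_ne_zero ha (hx i)) (fun _ _ => hb) hcs
        (fun _ _ => hd) hes (fun _ _ => div_ne_zero hf (hx i))).continuousOn.continuousAt h1U
    exact (Continuous.matrix_det continuous_id).continuousAt.comp
      (continuousAt_pi.mpr fun i => continuousAt_pi.mpr fun k => hentry i k)
  have hRc : ContinuousAt R 1 := by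
    have hqF := continuous_qFac hq
    have hqP : ∀ j, Continuous fun z => qPoch q z j := fun j => (differentiable_qPoch q j).continuous
    have h1 : ContinuousAt (fun s : ℂ => c * s) 1 := by fun_prop
    have h2 : ContinuousAt (fun s : ℂ => e / s) 1 := continuousAt_const.div continuousAt_id one_ne_zero
    have hc1 : c * 1 ≠ 0 := by simpa using hc
    have he1 : e / 1 ≠ 0 := by simpa using he
    have hF : ∀ {u v : ℂ → ℂ} (w : ℂ), ContinuousAt u 1 → ContinuousAt v 1 → u 1 ≠ 0 → v 1 ≠ 0 →
        ContinuousAt (fun s => qFac q (w / (u s * v s))) 1 := fun w hu hv hu0 hv0 =>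
      hqF.continuousAt.comp (continuousAt_const.div (hu.mul hv) (mul_ne_zero hu0 hv0))
    have hF' : ∀ {u v : ℂ → ℂ} (w : ℂ) (j : ℕ), ContinuousAt u 1 → ContinuousAt v 1 →
        u 1 ≠ 0 → v 1 ≠ 0 → ContinuousAt (fun s => qFac q (w / (u s * v s) / q ^ j)) 1 :=
      fun w j hu hv hu0 hv0 => hqF.continuousAt.comp
        ((continuousAt_const.div (hu.mul hv) (mul_ne_zero hu0 hv0)).div_const _)
    have hP : ∀ {u : ℂ → ℂ} (j : ℕ), ContinuousAt u 1 →
        ContinuousAt (fun s => qPoch q (b * u s / a) j) 1 := fun j hu =>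
      (hqP j).continuousAt.comp ((hu.const_mul b).div_const a)
    refine (continuousAt_const.mul (tendsto_finsetProd _ fun i _ => ?_)).mul
      (tendsto_finsetProd _ fun j _ => ?_)
    · exact continuousAt_const.mul (((hF _ h1 continuousAt_const hc1 hf).mul
        continuousAt_const).mul (hF _ h2 continuousAt_const he1 hf))
    · exact ((((hP j h1).mul continuousAt_const).mul (hP j h2))).mul
        (((hF' _ j h1 continuousAt_const hc1 hd).mul (hF' _ j h1 h2 hc1 he1)).mul
          (hF' _ j continuousAt_const h2 hd he1))
  have hev : L =ᶠ[𝓝[≠] 1] R := by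
    filter_upwards [splitConst_ne_zero_of_perturbation (a := a) hq0 hc hd r,
      mem_nhdsWithin_of_mem_nhds h1U] with s hs hs0
    have hs0' : s ≠ 0 := hs0
    refine det_jacksonForm_of_ne_zero hq hq0 ha hb (hcs s hs0) hd (hes s hs0) hf hx ?_ hs
    rw [hbal]
    field_simp
  have := tendsto_nhds_unique_of_eventuallyEq (hLc.mono_left nhdsWithin_le_nhds)
    (hRc.mono_left nhdsWithin_le_nhds) hev
  simpa [hL, hR] using this

end

/-! ### Return to the original integrand and its denominators. -/

/-- The one-dimensional very-well-poised weight with parameters `p, b, c, d, e, g`. -/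
noncomputable def vwpWeight (q a p b c d e g t : ℂ) : ℂ :=
  (1 - t ^ 2 / a) *
    (qFacs q [q * t / p, q * t / b, q * t / c, q * t / d, q * t / e, q * t / g] /
      qFacs q [p * t / a, b * t / a, c * t / a, d * t / a, e * t / a, g * t / a])

theorem vwpWeight_swap (q a p b c d e g t : ℂ) :
    vwpWeight q a p b c d e g t = vwpWeight q a b p c d e g t := by
  simp only [vwpWeight, qFacs, List.map, List.prod_cons, List.prod_nil]
  congr 1
  congr 1 <;> ring

section
variable {q : ℂ} (hq : ‖q‖ < 1)
include hq

/-- At `t = p q^k` each denominator is a tail of `(pu/a; q)_∞`. Completing it to the full product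
puts `(pu/a; q)_k` in the numerator, as in `nodeFactor`. -/
theorem vwpWeight_node {a p b c d e g : ℂ}
    (hpp : ∀ k : ℕ, p * p / a * q ^ k ≠ 1) (hpb : ∀ k : ℕ, p * b / a * q ^ k ≠ 1)
    (hpc : ∀ k : ℕ, p * c / a * q ^ k ≠ 1) (hpd : ∀ k : ℕ, p * d / a * q ^ k ≠ 1)
    (hpe : ∀ k : ℕ, p * e / a * q ^ k ≠ 1) (hpg : ∀ k : ℕ, p * g / a * q ^ k ≠ 1) (k : ℕ) :
    vwpWeight q a p b c d e g (p * q ^ k) * q ^ k =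
      jacksonTerm q a p b c d e g k / (qFac q (p * p / a) * qFac q (p * b / a) *
        (qFac q (p * c / a) * qFac q (p * d / a) * qFac q (p * e / a) * qFac q (p * g / a))) := by
  have h : ∀ u : ℂ, (∀ k : ℕ, p * u / a * q ^ k ≠ 1) →
      qFac q (q * (p * q ^ k) / u) / qFac q (u * (p * q ^ k) / a) =
        nodeFactor q a k p u / qFac q (p * u / a) := by
    intro u hu
    have h1 : qFac q (p * u / a * q ^ k) ≠ 0 := by
      refine qFac_ne_zero hq fun l => ?_
      rw [mul_assoc, ← pow_add]
      exact hu _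
    rw [div_eq_div_iff (by rwa [show u * (p * q ^ k) / a = p * u / a * q ^ k by ring])
      (qFac_ne_zero hq hu), nodeFactor, qFac_eq_qPoch_mul hq (p * u / a) k]
    ring_nf
  have hdiv : ∀ A B C D E F A' B' C' D' E' F' : ℂ,
      (A * (B * (C * (D * (E * (F * 1)))))) / (A' * (B' * (C' * (D' * (E' * (F' * 1)))))) =
        A / A' * (B / B') * (C / C') * (D / D') * (E / E') * (F / F') := by
    intros
    simp only [div_eq_mul_inv, mul_inv]
    ring
  simp only [vwpWeight, qFacs, List.map, List.prod_cons, List.prod_nil]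
  rw [hdiv, h p hpp, h b hpb, h c hpc, h d hpd, h e hpe, h g hpg, jacksonTerm]
  simp only [div_eq_mul_inv, mul_inv]
  ring

theorem jacksonInt_vwpWeight {m : ℂ → ℂ} (hm : Continuous m) {a p b c d e g : ℂ}
    (hpp : ∀ k : ℕ, p * p / a * q ^ k ≠ 1) (hpb : ∀ k : ℕ, p * b / a * q ^ k ≠ 1)
    (hpc : ∀ k : ℕ, p * c / a * q ^ k ≠ 1) (hpd : ∀ k : ℕ, p * d / a * q ^ k ≠ 1)
    (hpe : ∀ k : ℕ, p * e / a * q ^ k ≠ 1) (hpg : ∀ k : ℕ, p * g / a * q ^ k ≠ 1)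
    (hbb : ∀ k : ℕ, b * b / a * q ^ k ≠ 1)
    (hbc : ∀ k : ℕ, b * c / a * q ^ k ≠ 1) (hbd : ∀ k : ℕ, b * d / a * q ^ k ≠ 1)
    (hbe : ∀ k : ℕ, b * e / a * q ^ k ≠ 1) (hbg : ∀ k : ℕ, b * g / a * q ^ k ≠ 1) :
    (Summable fun k : ℕ => vwpWeight q a p b c d e g (p * q ^ k) * m (p * q ^ k) * q ^ k) ∧
    (Summable fun k : ℕ => vwpWeight q a p b c d e g (b * q ^ k) * m (b * q ^ k) * q ^ k) ∧
    jacksonInt q p b (fun t => vwpWeight q a p b c d e g t * m t) =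
      ((qFac q (p * p / a) * qFac q (b * b / a) * qFac q (p * b / a)) *
        ((qFac q (p * c / a) * qFac q (p * d / a) * qFac q (p * e / a) * qFac q (p * g / a)) *
        (qFac q (b * c / a) * qFac q (b * d / a) * qFac q (b * e / a) *
          qFac q (b * g / a))))⁻¹ * jacksonForm q a m p b c d e g := by
  have hbp : ∀ k : ℕ, b * p / a * q ^ k ≠ 1 := fun k => by
    rw [mul_comm b p]; exact hpb k
  have h1 : ∀ k : ℕ, vwpWeight q a p b c d e g (p * q ^ k) * m (p * q ^ k) * q ^ k =
      m (p * q ^ k) * jacksonTerm q a p b c d e g k / (qFac q (p * p / a) * qFac q (p * b / a) *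
        (qFac q (p * c / a) * qFac q (p * d / a) * qFac q (p * e / a) * qFac q (p * g / a))) :=
    fun k => by
      rw [mul_right_comm, vwpWeight_node hq hpp hpb hpc hpd hpe hpg k]
      ring
  have h2 : ∀ k : ℕ, vwpWeight q a p b c d e g (b * q ^ k) * m (b * q ^ k) * q ^ k =
      m (b * q ^ k) * jacksonTerm q a b p c d e g k / (qFac q (b * b / a) * qFac q (b * p / a) *
        (qFac q (b * c / a) * qFac q (b * d / a) * qFac q (b * e / a) * qFac q (b * g / a))) :=
    fun k => by
      rw [vwpWeight_swap, mul_right_comm, vwpWeight_node hq hbb hbp hbc hbd hbe hbg k]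
      ring
  refine ⟨?_, ?_, ?_⟩
  · simp only [h1]
    exact (summable_jackson hq hm a p b c d e g).div_const _
  · simp only [h2]
    exact (summable_jackson hq hm a b p c d e g).div_const _
  · rw [jacksonInt]
    simp only [h1, h2, tsum_div_const]
    rw [jacksonForm, mul_comm b p]
    have n1 := qFac_ne_zero hq hpp
    have n2 := qFac_ne_zero hq hpb
    have n3 := qFac_ne_zero hq hpc
    have n4 := qFac_ne_zero hq hpd
    have n5 := qFac_ne_zero hq hpe
    have n6 := qFac_ne_zero hq hpg
    have n7 := qFac_ne_zero hq hbb
    have n8 := qFac_ne_zero hq hbc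
    have n9 := qFac_ne_zero hq hbd
    have n10 := qFac_ne_zero hq hbe
    have n11 := qFac_ne_zero hq hbg
    have e1 : jacksonSeries q a m p b c d e g =
      ∑' k : ℕ, m (p * q ^ k) * jacksonTerm q a p b c d e g k := rfl
    have e2 : jacksonSeries q a m b p c d e g =
      ∑' k : ℕ, m (b * q ^ k) * jacksonTerm q a b p c d e g k := rfl
    rw [← e1, ← e2]
    generalize qFac q (p * p / a) = X1 at *
    generalize qFac q (p * b / a) = X2 at *
    generalize qFac q (b * b / a) = X3 at *
    generalize qFac q (p * c / a) = X4 at *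
    generalize qFac q (p * d / a) = X5 at *
    generalize qFac q (p * e / a) = X6 at *
    generalize qFac q (p * g / a) = X7 at *
    field_simp

end

theorem crIntegrand_eq {r : ℕ} {a : ℂ} (ha : a ≠ 0) (q b c d e f : ℂ) {x : Fin r → ℂ}
    (hx : ∀ i, x i ≠ 0) :
    crIntegrand q a b c d e f x = fun t => ((-a) ^ r.choose 2)⁻¹ *
      (Matrix.of fun i l : Fin r =>
        vwpWeight q a (a * x i) b c d e (f / x i) (t i) * pairWeight a r l (t i)).det := by
  funext t
  have h := Matrix.det_mul_column
    (fun i => vwpWeight q a (a * x i) b c d e (f / x i) (t i))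
    (Matrix.of fun i l : Fin r => pairWeight a r l (t i))
  simp only [Matrix.of_apply] at h
  have h2 := prod_pair_eq_det ha t
  rw [crIntegrand, h2, h, mul_assoc, mul_assoc, ← Finset.prod_mul_distrib, mul_comm (∏ i, _)]
  congr 2
  refine Finset.prod_congr rfl fun i _ => ?_
  have hxi := hx i
  have e1 : a * x i * t i / a = t i * x i := by field_simp
  have e2 : q * t i / (f / x i) = q * t i * x i / f := by
    rw [div_div_eq_mul_div]
  have e3 : f / x i * t i / a = f * t i / (a * x i) := by
    rw [div_mul_eq_mul_div, div_div, mul_comm (x i)]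
  rw [vwpWeight, e1, e2, e3]

/-- The products `(ax²; q)_∞` and `(b²/a; q)_∞` in `endFactor` cancel against the denominators. The
finite factors shorten `(bu/a; q)_∞` to `(bu q^i/a; q)_∞` for `u = c, d, e`. -/
theorem product_factor_eq {q : ℂ} (hq : ‖q‖ < 1) (hq0 : q ≠ 0) {a b c d e f x : ℂ}
    (ha : a ≠ 0) (hx : x ≠ 0) (haxx : ∀ k : ℕ, a * x ^ 2 * q ^ k ≠ 1)
    (hbb : ∀ k : ℕ, b ^ 2 / a * q ^ k ≠ 1)
    (hbc : ∀ k : ℕ, b * c / a * q ^ k ≠ 1) (hbd : ∀ k : ℕ, b * d / a * q ^ k ≠ 1)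
    (hbe : ∀ k : ℕ, b * e / a * q ^ k ≠ 1)
    (i : ℕ) :
    ((qFac q (a * x * (a * x) / a) * qFac q (b * b / a) * qFac q (a * x * b / a)) *
        ((qFac q (a * x * c / a) * qFac q (a * x * d / a) * qFac q (a * x * e / a) *
          qFac q (a * x * (f / x) / a)) * (qFac q (b * c / a) * qFac q (b * d / a) *
            qFac q (b * e / a) * qFac q (b * (f / x) / a))))⁻¹ *
        (endFactor q a (a * x) b * (qFac q (a * x * q / (c * f)) *
          qFac q (a * x * q / (d * f)) * qFac q (a * x * q / (e * f)))) *
        ((qPoch q (b * c / a) i * qPoch q (b * d / a) i *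
          qPoch q (b * e / a) i) * (qFac q (a * q / (c * d) / q ^ i) *
          qFac q (a * q / (c * e) / q ^ i) * qFac q (a * q / (d * e) / q ^ i))) =
      b * (qFacs q [q, a * x / b, b * q / (a * x),
              a * q ^ (1 - (i : ℤ)) / (c * d), a * q ^ (1 - (i : ℤ)) / (c * e)] /
            qFacs q [b * x, c * x, d * x, e * x, f]) *
        (qFacs q [a * x * q / (c * f), a * q ^ (1 - (i : ℤ)) / (d * e),
              a * x * q / (d * f), a * x * q / (e * f)] /
            qFacs q [b * c * q ^ i / a, b * d * q ^ i / a,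
              b * e * q ^ i / a, b * f / (a * x)]) := by
  have cpp : a * x * (a * x) / a = a * x ^ 2 := by field_simp
  have cpu : ∀ u, a * x * u / a = u * x := fun u => by field_simp
  have cbb : b * b / a = b ^ 2 / a := by ring
  have cbg : b * (f / x) / a = b * f / (a * x) := by field_simp
  have hz : ∀ u v : ℂ, a * q ^ (1 - (i : ℤ)) / (u * v) = a * q / (u * v) / q ^ i := by
    intro u v
    rw [zpow_sub₀ hq0, zpow_one, zpow_natCast]
    ring
  have hsplit : ∀ u : ℂ, (∀ k : ℕ, b * u / a * q ^ k ≠ 1) →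
      qPoch q (b * u / a) i / qFac q (b * u / a) = 1 / qFac q (b * u * q ^ i / a) := by
    intro u hu
    have h1 := qPoch_ne_zero hu i
    rw [qFac_eq_qPoch_mul hq (b * u / a) i,
      show b * u / a * q ^ i = b * u * q ^ i / a by ring]
    rw [div_mul_eq_div_div, div_self h1]
  have hfx : f / x * x = f := div_mul_cancel₀ f hx
  simp only [hz, qFacs, List.map, List.prod_cons, List.prod_nil, mul_one, endFactor,
    cpp, cpu, hfx, cbb, cbg]
  have s1 := hsplit c hbc
  have s2 := hsplit d hbd
  have s3 := hsplit e hbe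
  have hdiv : ∀ A B C D A' B' C' D' : ℂ, A * (B * (C * D)) / (A' * (B' * (C' * D'))) =
      A * B * C * D / D' * ((1 / A') * (1 / B') * (1 / C')) := by
    intros
    simp only [div_eq_mul_inv, mul_inv]
    ring
  rw [mul_comm b q, hdiv (qFac q (a * x * q / (c * f))), ← s1, ← s2, ← s3]
  have alg : ∀ {X1 X2 : ℂ} (X3 X4 X5 X6 X7 X8 X9 X10 X11 Z1 Z2 Z3 Z4 Z5 Z6 Z7 Z8 Z9 P1 P2 P3 : ℂ),
      X1 ≠ 0 → X2 ≠ 0 →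
      ((X1 * X2 * X3) * ((X4 * X5 * X6 * X7) * (X8 * X9 * X10 * X11)))⁻¹ *
        (b * (Z1 * Z2 * Z3 * X1 * X2) * (Z7 * Z8 * Z9)) * ((P1 * P2 * P3) * (Z4 * Z5 * Z6)) =
      b * ((Z1 * (Z2 * (Z3 * (Z4 * Z5)))) / (X3 * (X4 * (X5 * (X6 * X7))))) *
        (Z7 * Z6 * Z8 * Z9 / X11 * (P1 / X8 * (P2 / X9) * (P3 / X10))) := by
    intro X1 X2 X3 X4 X5 X6 X7 X8 X9 X10 X11 Z1 Z2 Z3 Z4 Z5 Z6 Z7 Z8 Z9 P1 P2 P3 h1 h2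
    have h : (X1 * X2 * X3 * (X4 * X5 * X6 * X7 * (X8 * X9 * X10 * X11)))⁻¹ * (X1 * X2) =
        (X3 * (X4 * X5 * X6 * X7 * (X8 * X9 * X10 * X11)))⁻¹ := by
      rw [mul_assoc (X1 * X2), mul_inv (X1 * X2), mul_comm, ← mul_assoc,
        mul_inv_cancel₀ (mul_ne_zero h1 h2), one_mul]
    calc _ = ((X1 * X2 * X3 * (X4 * X5 * X6 * X7 * (X8 * X9 * X10 * X11)))⁻¹ * (X1 * X2)) *
          (b * (Z1 * Z2 * Z3) * (Z7 * Z8 * Z9) * ((P1 * P2 * P3) * (Z4 * Z5 * Z6))) := by ac_rfl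
      _ = _ := by
        rw [h]
        simp only [div_eq_mul_inv, mul_inv]
        ring
  exact alg _ _ _ _ _ _ _ _ _ _ _ _ _ _ _ _ _ _ _ _ _ (qFac_ne_zero hq haxx) (qFac_ne_zero hq hbb)

theorem theorem4p1 (r : ℕ) (q a b c d e f : ℂ) (x : Fin r → ℂ)
    (hq0 : q ≠ 0) (hq1 : ‖q‖ < 1)
    (ha : a ≠ 0) (hx : ∀ i, x i ≠ 0)
    (hbal : a ^ 2 * q ^ (2 - (r : ℤ)) = b * c * d * e * f)
    -- no denominator vanishes at a point `a * x i * q ^ k`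
    (haxx : ∀ i, ∀ k : ℕ, a * x i ^ 2 * q ^ k ≠ 1)
    (hbx : ∀ i, ∀ k : ℕ, b * x i * q ^ k ≠ 1)
    (hcx : ∀ i, ∀ k : ℕ, c * x i * q ^ k ≠ 1)
    (hdx : ∀ i, ∀ k : ℕ, d * x i * q ^ k ≠ 1)
    (hex : ∀ i, ∀ k : ℕ, e * x i * q ^ k ≠ 1)
    (hf : ∀ k : ℕ, f * q ^ k ≠ 1)
    -- no denominator vanishes at a point `b * q ^ k`
    (hbb : ∀ k : ℕ, b ^ 2 / a * q ^ k ≠ 1)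
    (hbc : ∀ k : ℕ, b * c / a * q ^ k ≠ 1)
    (hbd : ∀ k : ℕ, b * d / a * q ^ k ≠ 1)
    (hbe : ∀ k : ℕ, b * e / a * q ^ k ≠ 1)
    (hbf : ∀ i, ∀ k : ℕ, b * f / (a * x i) * q ^ k ≠ 1) :
    QIntegrable q (fun i => a * x i) (fun _ => b) (crIntegrand q a b c d e f x) ∧
    qIntegral q (fun i => a * x i) (fun _ => b) (crIntegrand q a b c d e f x) =
      a ^ r.choose 2 * b ^ r * (1 - q) ^ r *
        (∏ i, ∏ j ∈ Finset.Ioi i, (x i - x j) * (1 - a * x i * x j / f)) *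
        (∏ i : Fin r,
          qFacs q [q, a * x i / b, b * q / (a * x i),
              a * q ^ (1 - (i : ℤ)) / (c * d), a * q ^ (1 - (i : ℤ)) / (c * e)] /
            qFacs q [b * x i, c * x i, d * x i, e * x i, f]) *
        ∏ i : Fin r,
          qFacs q [a * x i * q / (c * f), a * q ^ (1 - (i : ℤ)) / (d * e),
              a * x i * q / (d * f), a * x i * q / (e * f)] /
            qFacs q [b * c * q ^ (i : ℕ) / a, b * d * q ^ (i : ℕ) / a,
              b * e * q ^ (i : ℕ) / a, b * f / (a * x i)] := by
  have hbal' : a ^ 2 * q ^ 2 = b * c * d * e * f * q ^ r := by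
    rw [← hbal, mul_assoc, ← zpow_natCast q r, ← zpow_add₀ hq0]
    simp
  have hne : b * c * d * e * f ≠ 0 := by
    rw [← hbal]
    exact mul_ne_zero (pow_ne_zero 2 ha) (zpow_ne_zero _ hq0)
  have hf0 : f ≠ 0 := fun h => hne (by simp [h])
  have he0 : e ≠ 0 := fun h => hne (by simp [h])
  have hd0 : d ≠ 0 := fun h => hne (by simp [h])
  have hc0 : c ≠ 0 := fun h => hne (by simp [h])
  have hb0 : b ≠ 0 := fun h => hne (by simp [h])
  have cpp : ∀ i, a * x i * (a * x i) / a = a * x i ^ 2 := fun i => by field_simp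
  have cpu : ∀ i u, a * x i * u / a = u * x i := fun i u => by field_simp
  have cpg : ∀ i, a * x i * (f / x i) / a = f := fun i => by
    have := hx i
    field_simp
  have cbb : b * b / a = b ^ 2 / a := by ring
  have cbg : ∀ i, b * (f / x i) / a = b * f / (a * x i) := fun i => by
    have := hx i
    field_simp
  have key := fun i l => jacksonInt_vwpWeight hq1 (m := pairWeight a r l)
    (differentiable_pairWeight a r l).continuous (a := a) (p := a * x i) (b := b) (c := c)
    (d := d) (e := e) (g := f / x i) (by simpa only [cpp] using haxx i)
    (by simpa only [cpu] using hbx i) (by simpa only [cpu] using hcx i)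
    (by simpa only [cpu] using hdx i) (by simpa only [cpu] using hex i)
    (by simpa only [cpg] using hf) (by simpa only [cbb] using hbb) hbc hbd hbe
    (by simpa only [cbg] using hbf i)
  obtain ⟨hint, hval⟩ := qIntegral_det q ((-a) ^ r.choose 2)⁻¹ (fun i => a * x i) (fun _ => b)
    (fun i (l : Fin r) t =>
      vwpWeight q a (a * x i) b c d e (f / x i) t * pairWeight a r l t)
    (fun i l => (key i l).1) (fun i l => (key i l).2.1)
  rw [crIntegrand_eq ha q b c d e f hx]
  refine ⟨hint, ?_⟩
  rw [hval]
  simp only [(key _ _).2.2]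
  have hcol := Matrix.det_mul_column (fun i => ((qFac q (a * x i * (a * x i) / a) *
    qFac q (b * b / a) * qFac q (a * x i * b / a)) *
        ((qFac q (a * x i * c / a) * qFac q (a * x i * d / a) * qFac q (a * x i * e / a) *
          qFac q (a * x i * (f / x i) / a)) * (qFac q (b * c / a) * qFac q (b * d / a) *
            qFac q (b * e / a) * qFac q (b * (f / x i) / a))))⁻¹)
    (Matrix.of fun i l : Fin r =>
      jacksonForm q a (pairWeight a r l) (a * x i) b c d e (f / x i))
  simp only [Matrix.of_apply] at hcol
  rw [hcol, det_jacksonForm hq1 hq0 ha hb0 hc0 hd0 he0 hf0 hx hbal']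
  -- The sign and one power of `a` come from the Vandermonde determinant in `t`; they reduce the
  -- determinant's `a ^ (r (r - 1))` to `a ^ r.choose 2`.
  have hsign : ((-a) ^ r.choose 2)⁻¹ * ((-1) ^ r.choose 2 * (a ^ r.choose 2) ^ 2) =
      a ^ r.choose 2 := by
    have h1 : ((-1 : ℂ)) ^ r.choose 2 ≠ 0 := by simp
    have h2 := pow_ne_zero (r.choose 2) ha
    rw [neg_pow a]
    field_simp
  rw [← Fin.prod_univ_eq_prod_range (fun j => (qPoch q (b * c / a) j * qPoch q (b * d / a) j *
          qPoch q (b * e / a) j) * (qFac q (a * q / (c * d) / q ^ j) *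
          qFac q (a * q / (c * e) / q ^ j) * qFac q (a * q / (d * e) / q ^ j)))]
  have hbr : b ^ r = ∏ _i : Fin r, b := by simp
  rw [hbr]
  calc _ = (((-a) ^ r.choose 2)⁻¹ * ((-1) ^ r.choose 2 * (a ^ r.choose 2) ^ 2)) * (1 - q) ^ r *
        (∏ i, ∏ j ∈ Finset.Ioi i, (x i - x j) * (1 - a * x i * x j / f)) *
        ((∏ i, ((qFac q (a * x i * (a * x i) / a) *
    qFac q (b * b / a) * qFac q (a * x i * b / a)) *
        ((qFac q (a * x i * c / a) * qFac q (a * x i * d / a) * qFac q (a * x i * e / a) *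
          qFac q (a * x i * (f / x i) / a)) * (qFac q (b * c / a) * qFac q (b * d / a) *
            qFac q (b * e / a) * qFac q (b * (f / x i) / a))))⁻¹) *
        (∏ i, endFactor q a (a * x i) b * (qFac q (a * x i * q / (c * f)) *
          qFac q (a * x i * q / (d * f)) * qFac q (a * x i * q / (e * f)))) *
        ∏ j : Fin r, (qPoch q (b * c / a) j * qPoch q (b * d / a) j *
          qPoch q (b * e / a) j) * (qFac q (a * q / (c * d) / q ^ (j : ℕ)) *
          qFac q (a * q / (c * e) / q ^ (j : ℕ)) * qFac q (a * q / (d * e) / q ^ (j : ℕ)))) := by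
        ring
    _ = a ^ r.choose 2 * (1 - q) ^ r *
        (∏ i, ∏ j ∈ Finset.Ioi i, (x i - x j) * (1 - a * x i * x j / f)) *
        ((∏ _i : Fin r, b) * (∏ i : Fin r,
          qFacs q [q, a * x i / b, b * q / (a * x i),
              a * q ^ (1 - (i : ℤ)) / (c * d), a * q ^ (1 - (i : ℤ)) / (c * e)] /
            qFacs q [b * x i, c * x i, d * x i, e * x i, f]) *
        ∏ i : Fin r,
          qFacs q [a * x i * q / (c * f), a * q ^ (1 - (i : ℤ)) / (d * e),
              a * x i * q / (d * f), a * x i * q / (e * f)] /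
            qFacs q [b * c * q ^ (i : ℕ) / a, b * d * q ^ (i : ℕ) / a,
              b * e * q ^ (i : ℕ) / a, b * f / (a * x i)]) := by
        rw [hsign]
        congr 1
        simp only [← Finset.prod_mul_distrib]
        refine Finset.prod_congr rfl fun i _ => ?_
        exact product_factor_eq hq1 hq0 ha (hx i) (haxx i) hbb hbc hbd hbe i
    _ = _ := by ring
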